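/- Let $0\le\alpha<2$. Let $H^1_\alpha(0,1)$ be the space of real functions $u\in L^2(0,1)$ that are absolutely continuous on $[0,1]$ if $\alpha<1$, locally absolutely continuous on $(0,1]$ if $\alpha\ge 1$, and satisfy $x^{\alpha/2}u_x\in L^2(0,1)$, with norm $\|u\|^2=\int_0^1(u^2+x^\alpha u_x^2)\,dx$. Let $Au=(x^\alpha u_x)_x$ in $L^2(0,1)$, with domain $$D(A)=\{u\in H^1_\alpha(0,1):\ x^\alpha u_x\in H^1(0,1),\ (x^\alpha u_x)(0)=0,\ u_x(1)=0\}.$$ On $\mathcal X=H^1_\alpha(0,1)\times L^2(0,1)$ let $\mathcal A(w_0,w_1)=(w_1,Aw_0)$ with $D(\mathcal A)=D(A)\times H^1_\alpha(0,1)$, equipped with the graph norm $\|W\|_{D(\mathcal A)}^2=\|W\|_{\mathcal X}^2+\|\mathcal AW\|_{\mathcal X}^2$. Let $V^1_\alpha=H^1_\alpha(0,1)$ if $\alpha<1$ and $V^1_\alpha=\{\mu\in H^1_\alpha(0,1):x^{\alpha/2}\mu_x\in L^\infty(0,1)\}$ if $\alpha\ge1$, and for $\mu\in V^1_\alpha$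 put $\mathcal B(w_0,w_1)=(0,\mu w_0)$. **Proposition.** The operator $\mathcal A$ generates a strongly continuous semigroup $(e^{\mathcal At})_{t\ge0}$ on $\mathcal X$. Let $T>0$, $p\in L^2(0,T)$ and $\mu\in V^1_\alpha$. For every $f\in L^2(0,T;H^1_\alpha(0,1))$, with $\mathcal F=(0,f)$, and every $\mathcal W_0\in D(\mathcal A)$, the problem $$\mathcal W'(t)=\mathcal A\mathcal W(t)+p(t)\mathcal B\mathcal W(t)+\mathcal F(t),\qquad \mathcal W(0)=\mathcal W_0,$$ has a unique classical solution, i.e. there is a unique $\mathcal W\in C^0([0,T],D(\mathcal A))$ such that for every $t\in[0,T]$ $$\mathcal W(t)=e^{\mathcal At}\mathcal W_0+\int_0^t e^{\mathcal A(t-s)}\bigl(p(s)\mathcal B\mathcal W(s)+\mathcal F(s)\bigr)\,ds\quad\text{in } D(\mathcal A).$$ Moreover, there is a constant $C>0$, depending only on $\alpha,T,p,\mu$ (not on $f$ and $\mathcal W_0$), such that $$\|\mathcal W\|_{C^0([0,T],D(\mathcal A))}\le C\bigl(\|\mathcal W_0\|_{D(\mathcal A)}+\|\mathcal F\|_{L^2(0,T;D(\mathcal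 A))}\bigr).$$ -/

import Mathlib

open MeasureTheory Set Filter Topology
open scoped NNReal ENNReal

noncomputable section

namespace DegenerateWave

/-! ### Unbounded operators and the graph norm -/

section GraphSpace

variable {E F : Type*} [NormedAddCommGroup E] [NormedSpace ℝ E]
  [NormedAddCommGroup F] [NormedSpace ℝ F]

/-- The domain of an unbounded operator `A : D(A) ⊆ E → F`, regarded as a normed space for the
graph norm `‖x‖² = ‖x‖_E² + ‖A x‖_F²`. -/
def GraphSpace (A : E →ₗ.[ℝ] F) : Type _ := A.domain

namespace GraphSpace

variable (A : E →ₗ.[ℝ] F)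

instance : AddCommGroup (GraphSpace A) := inferInstanceAs (AddCommGroup A.domain)

instance : Module ℝ (GraphSpace A) := inferInstanceAs (Module ℝ A.domain)

/-- The map `x ↦ (x, A x)` from `D(A)` to the product `E × F` with its `ℓ²` product norm. -/
def toGraph : GraphSpace A →ₗ[ℝ] WithLp 2 (E × F) :=
  (WithLp.linearEquiv 2 ℝ (E × F)).symm.toLinearMap ∘ₗ (A.domain.subtype.prod A.toFun)

theorem toGraph_injective : Function.Injective (toGraph A) := by
  intro x y h
  exact Subtype.ext (congrArg (fun z : WithLp 2 (E × F) => z.fst) h)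

instance : NormedAddCommGroup (GraphSpace A) :=
  NormedAddCommGroup.induced (GraphSpace A) (WithLp 2 (E × F)) (toGraph A) (toGraph_injective A)

instance : NormedSpace ℝ (GraphSpace A) :=
  NormedSpace.induced ℝ (GraphSpace A) (WithLp 2 (E × F)) (toGraph A)

variable {A}

/-- The element of `E` underlying an element of `D(A)`. -/
def val (x : GraphSpace A) : E := A.domain.subtype x

/-- The value `A x`, for `x ∈ D(A)`. -/
def image (x : GraphSpace A) : F := A.toFun x

/-- An element of `E` in the domain of `A`, as an element of the normed space `D(A)`. -/
def mk (x : E) (hx : x ∈ A.domain) : GraphSpace A := (⟨x, hx⟩ : A.domain)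

theorem norm_sq (x : GraphSpace A) : ‖x‖ ^ 2 = ‖x.val‖ ^ 2 + ‖x.image‖ ^ 2 :=
  WithLp.prod_norm_sq_eq_of_L2 (toGraph A x)

end GraphSpace

end GraphSpace

/-! ### Strongly continuous semigroups -/

/-- A strongly continuous (`C₀`) semigroup of bounded operators on `X`. -/
structure C0Semigroup (X : Type*) [NormedAddCommGroup X] [NormedSpace ℝ X] where
  /-- the operator at time `t` -/
  op : ℝ≥0 → X →L[ℝ] X
  op_zero : op 0 = ContinuousLinearMap.id ℝ X
  op_add : ∀ s t, op (s + t) = (op s).comp (op t)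
  continuous_orbit : ∀ x, Continuous fun t => op t x

namespace C0Semigroup

variable {X : Type*} [NormedAddCommGroup X] [NormedSpace ℝ X]

/-- `A` is the infinitesimal generator of the semigroup `S`, i.e. `S t = e^{tA}`: one has
`x ∈ D(A)` and `A x = y` exactly when `(S h x - x) / h` tends to `y` as `h → 0⁺`. -/
def IsGeneratedBy (S : C0Semigroup X) (A : X →ₗ.[ℝ] X) : Prop :=
  ∀ x y : X, (x, y) ∈ A.graph ↔
    Tendsto (fun h : ℝ≥0 => (h : ℝ)⁻¹ • (S.op h x - x)) (𝓝[>] 0) (𝓝 y)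

theorem IsGeneratedBy.graph_op {S : C0Semigroup X} {A : X →ₗ.[ℝ] X} (hS : S.IsGeneratedBy A)
    (t : ℝ≥0) {x y : X} (h : (x, y) ∈ A.graph) : (S.op t x, S.op t y) ∈ A.graph := by
  rw [hS] at h ⊢
  refine (((S.op t).continuous.tendsto y).comp h).congr fun r => ?_
  have h1 : S.op r (S.op t x) = S.op t (S.op r x) := by
    rw [← ContinuousLinearMap.comp_apply, ← ContinuousLinearMap.comp_apply, ← S.op_add,
      ← S.op_add, add_comm]
  simp only [Function.comp_apply, map_smul, map_sub, h1]

/-- The semigroup generated by `A`, acting on `D(A)` (which it leaves invariant). -/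
def onDomain (S : C0Semigroup X) {A : X →ₗ.[ℝ] X} (hS : S.IsGeneratedBy A) (t : ℝ≥0)
    (x : GraphSpace A) : GraphSpace A :=
  GraphSpace.mk (S.op t x.val)
    (LinearPMap.mem_domain_of_mem_graph (hS.graph_op t (A.mem_graph x)))

end C0Semigroup

/-! ### The weighted Sobolev spaces -/

/-- The space `L²(0,1)` of real-valued functions. -/
abbrev L2I : Type := Lp ℝ 2 (volume.restrict (Ioo (0 : ℝ) 1))

/-- Absolute continuity on `[0,1]` if `α < 1`, local absolute continuity on `(0,1]`
if `1 ≤ α`. -/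
def IsAC (α : ℝ) (φ : ℝ → ℝ) : Prop :=
  if α < 1 then AbsolutelyContinuousOnInterval φ 0 1
  else ∀ ε ∈ Ioo (0 : ℝ) 1, AbsolutelyContinuousOnInterval φ ε 1

theorem IsAC.local {α : ℝ} {φ : ℝ → ℝ} (h : IsAC α φ) {ε : ℝ} (hε : ε ∈ Ioo (0 : ℝ) 1) :
    AbsolutelyContinuousOnInterval φ ε 1 := by
  unfold IsAC at h
  split_ifs at h with h1
  · refine h.mono ?_
    rw [uIcc_of_le hε.2.le, uIcc_of_le zero_le_one]
    exact Icc_subset_Icc_left hε.1.le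
  · exact h ε hε

theorem IsAC.continuousOn {α : ℝ} {φ : ℝ → ℝ} (h : IsAC α φ) : ContinuousOn φ (Ioo 0 1) := by
  intro x hx
  have h2 := (h.local (ε := x / 2) ⟨by linarith [hx.1], by linarith [hx.1, hx.2]⟩).continuousOn
  rw [uIcc_of_le (by linarith [hx.1, hx.2])] at h2
  exact (h2.continuousAt (Icc_mem_nhds (by linarith [hx.1]) hx.2)).continuousWithinAt

theorem IsAC.ae_differentiableAt {α : ℝ} {φ : ℝ → ℝ} (h : IsAC α φ) :
    ∀ᵐ x ∂(volume.restrict (Ioo (0 : ℝ) 1)), DifferentiableAt ℝ φ x := by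
  have key : ∀ n : ℕ, ∀ᵐ x : ℝ, x ∈ uIcc (1 / ((n : ℝ) + 2)) 1 → DifferentiableAt ℝ φ x := by
    intro n
    refine (h.local ⟨by positivity, ?_⟩).ae_differentiableAt
    rw [div_lt_one (by positivity)]
    have : (0 : ℝ) ≤ n := n.cast_nonneg
    linarith
  rw [ae_restrict_iff' measurableSet_Ioo]
  filter_upwards [ae_all_iff.2 key] with x hx hx01
  obtain ⟨n, hn⟩ := exists_nat_one_div_lt hx01.1
  refine hx n ?_
  have hle : 1 / ((n : ℝ) + 2) ≤ x := by
    refine le_trans ?_ hn.le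
    apply one_div_le_one_div_of_le <;> [positivity; linarith]
  rw [uIcc_of_le (hle.trans hx01.2.le)]
  exact ⟨hle, hx01.2.le⟩

theorem IsAC.zero (α : ℝ) : IsAC α (fun _ => 0) := by
  have h0 : ∀ a b : ℝ, AbsolutelyContinuousOnInterval (fun _ : ℝ => (0 : ℝ)) a b := by
    intro a b
    simpa [AbsolutelyContinuousOnInterval] using tendsto_const_nhds
  unfold IsAC
  split_ifs
  exacts [h0 _ _, fun _ _ => h0 _ _]

theorem IsAC.add {α : ℝ} {φ ψ : ℝ → ℝ} (h : IsAC α φ) (h' : IsAC α ψ) :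
    IsAC α (fun x => φ x + ψ x) := by
  unfold IsAC at *
  split_ifs at *
  exacts [h.fun_add h', fun ε hε => (h ε hε).fun_add (h' ε hε)]

theorem IsAC.const_mul {α : ℝ} {φ : ℝ → ℝ} (c : ℝ) (h : IsAC α φ) :
    IsAC α (fun x => c * φ x) := by
  unfold IsAC at *
  split_ifs at *
  exacts [h.const_mul c, fun ε hε => (h ε hε).const_mul c]

theorem IsAC.mul {α : ℝ} {φ ψ : ℝ → ℝ} (h : IsAC α φ) (h' : IsAC α ψ) :
    IsAC α (fun x => φ x * ψ x) := by
  unfold IsAC at *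
  split_ifs at *
  exacts [h.fun_mul h', fun ε hε => (h ε hε).fun_mul (h' ε hε)]

theorem eqOn_of_ae {φ ψ : ℝ → ℝ} (h : ContinuousOn φ (Ioo 0 1)) (h' : ContinuousOn ψ (Ioo 0 1))
    (e : φ =ᵐ[volume.restrict (Ioo (0 : ℝ) 1)] ψ) : EqOn φ ψ (Ioo 0 1) :=
  Measure.eqOn_open_of_ae_eq e isOpen_Ioo h h'

theorem deriv_eq_of_eqOn {φ ψ : ℝ → ℝ} (e : EqOn φ ψ (Ioo 0 1)) {x : ℝ} (hx : x ∈ Ioo (0 : ℝ) 1) :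
    deriv φ x = deriv ψ x :=
  (e.eventuallyEq_of_mem (isOpen_Ioo.mem_nhds hx)).deriv_eq

theorem ae_mem : ∀ᵐ x ∂(volume.restrict (Ioo (0 : ℝ) 1)), x ∈ Ioo (0 : ℝ) 1 :=
  ae_restrict_mem measurableSet_Ioo

/-- The pairs `(u, x^{α/2} u_x)` in `L²(0,1) × L²(0,1)`, where `u` has an absolutely continuous
representative (in the sense of `IsAC α`) with `x^{α/2} u_x ∈ L²(0,1)`. -/
def gradGraph (α : ℝ) : Submodule ℝ (L2I × L2I) where
  carrier := {z | ∃ φ : ℝ → ℝ, IsAC α φ ∧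
    z.1 =ᵐ[volume.restrict (Ioo (0 : ℝ) 1)] φ ∧
    z.2 =ᵐ[volume.restrict (Ioo (0 : ℝ) 1)] fun x => x ^ (α / 2) * deriv φ x}
  zero_mem' := by
    refine ⟨fun _ => 0, IsAC.zero α, Lp.coeFn_zero _ _ _, ?_⟩
    filter_upwards [Lp.coeFn_zero ℝ 2 (volume.restrict (Ioo (0 : ℝ) 1))] with x hx
    simpa using hx
  add_mem' := by
    rintro ⟨u, g⟩ ⟨u', g'⟩ ⟨φ, hφ, e1, e2⟩ ⟨ψ, hψ, e1', e2'⟩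
    refine ⟨_, hφ.add hψ, ?_, ?_⟩
    · filter_upwards [Lp.coeFn_add u u', e1, e1'] with x h h1 h2
      change (u + u') x = _
      rw [h, Pi.add_apply]
      exact congrArg₂ (· + ·) h1 h2
    · filter_upwards [Lp.coeFn_add g g', e2, e2', hφ.ae_differentiableAt,
        hψ.ae_differentiableAt] with x h h1 h2 d d'
      change (g + g') x = _
      rw [h, Pi.add_apply, deriv_fun_add d d', mul_add]
      exact congrArg₂ (· + ·) h1 h2
  smul_mem' := by
    rintro c ⟨u, g⟩ ⟨φ, hφ, e1, e2⟩
    refine ⟨_, hφ.const_mul c, ?_, ?_⟩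
    · filter_upwards [Lp.coeFn_smul c u, e1] with x h h1
      change (c • u) x = _
      rw [h, Pi.smul_apply, smul_eq_mul]
      exact congrArg (c * ·) h1
    · filter_upwards [Lp.coeFn_smul c g, e2, hφ.ae_differentiableAt] with x h h1 d
      change (c • g) x = _
      rw [h, Pi.smul_apply, smul_eq_mul, deriv_const_mul c d, mul_left_comm]
      exact congrArg (c * ·) h1

theorem gradGraph_functional (α : ℝ) (z : L2I × L2I) (hz : z ∈ gradGraph α) (h0 : z.1 = 0) :
    z.2 = 0 := by
  obtain ⟨φ, hφ, e1, e2⟩ := hz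
  rw [h0] at e1
  have e3 := eqOn_of_ae hφ.continuousOn continuousOn_const
    (e1.symm.trans (Lp.coeFn_zero ℝ 2 (volume.restrict (Ioo (0 : ℝ) 1))))
  apply Lp.ext
  filter_upwards [e2, ae_mem, Lp.coeFn_zero ℝ 2 (volume.restrict (Ioo (0 : ℝ) 1))] with x hx hx1 hx2
  rw [hx, hx2, deriv_eq_of_eqOn e3 hx1]
  simp

/-- The operator `u ↦ x^{α/2} u_x` in `L²(0,1)`; its domain is `H¹_α(0,1)`. -/
def wgrad (α : ℝ) : L2I →ₗ.[ℝ] L2I := (gradGraph α).toLinearPMap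

theorem wgrad_graph (α : ℝ) : (wgrad α).graph = gradGraph α :=
  Submodule.toLinearPMap_graph_eq _ (gradGraph_functional α)

/-- The space `H¹_α(0,1)`, with the norm `‖u‖² = ∫₀¹ (u² + x^α u_x²) dx`
of its natural scalar product. -/
abbrev H1 (α : ℝ) : Type := GraphSpace (wgrad α)

/-- The pairs `(u, (x^α u_x)_x)` with `u ∈ H²_α(0,1)`, `(x^α u_x)(0) = 0` and `u_x(1) = 0`.
Here `φ` is the absolutely continuous representative of `u`, and `q` is the continuous
representative on `[0,1]` of `x^α u_x ∈ H¹(0,1)`; `q x / x ^ α` is thus that of `u_x` on `(0,1]`,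
so that `u_x(1) = q 1`. -/
def ellGraph (α : ℝ) : Submodule ℝ (L2I × L2I) where
  carrier := {z | ∃ φ q : ℝ → ℝ, IsAC α φ ∧
    z.1 =ᵐ[volume.restrict (Ioo (0 : ℝ) 1)] φ ∧
    MemLp (fun x => x ^ (α / 2) * deriv φ x) 2 (volume.restrict (Ioo (0 : ℝ) 1)) ∧
    AbsolutelyContinuousOnInterval q 0 1 ∧
    q =ᵐ[volume.restrict (Ioo (0 : ℝ) 1)] (fun x => x ^ α * deriv φ x) ∧
    z.2 =ᵐ[volume.restrict (Ioo (0 : ℝ) 1)] deriv q ∧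
    q 0 = 0 ∧ q 1 = 0}
  zero_mem' := by
    have h0 : AbsolutelyContinuousOnInterval (fun _ : ℝ => (0 : ℝ)) 0 1 := by
      simpa [AbsolutelyContinuousOnInterval] using tendsto_const_nhds
    refine ⟨fun _ => 0, fun _ => 0, IsAC.zero α, Lp.coeFn_zero _ _ _, by simp, h0, by simp, ?_,
      rfl, rfl⟩
    filter_upwards [Lp.coeFn_zero ℝ 2 (volume.restrict (Ioo (0 : ℝ) 1))] with x hx
    simpa using hx
  add_mem' := by
    rintro ⟨u, g⟩ ⟨u', g'⟩ ⟨φ, q, hφ, e1, m, hq, eq, e2, a, b⟩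
      ⟨φ', q', hφ', e1', m', hq', eq', e2', a', b'⟩
    have acq : ∀ {r : ℝ → ℝ}, AbsolutelyContinuousOnInterval r 0 1 → IsAC 0 r := fun h => by
      simpa [IsAC] using h
    refine ⟨_, _, hφ.add hφ', ?_, ?_, hq.fun_add hq', ?_, ?_, by simp [a, a'], by simp [b, b']⟩
    · filter_upwards [Lp.coeFn_add u u', e1, e1'] with x h h1 h2
      change (u + u') x = _
      rw [h, Pi.add_apply]
      exact congrArg₂ (· + ·) h1 h2
    · refine (memLp_congr_ae ?_).1 (m.add m')
      filter_upwards [hφ.ae_differentiableAt, hφ'.ae_differentiableAt] with x d d'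
      rw [Pi.add_apply, deriv_fun_add d d', mul_add]
    · filter_upwards [eq, eq', hφ.ae_differentiableAt, hφ'.ae_differentiableAt] with x h1 h2 d d'
      rw [h1, h2, deriv_fun_add d d', mul_add]
    · filter_upwards [Lp.coeFn_add g g', e2, e2', (acq hq).ae_differentiableAt,
        (acq hq').ae_differentiableAt] with x h h1 h2 d d'
      change (g + g') x = _
      rw [h, Pi.add_apply, deriv_fun_add d d']
      exact congrArg₂ (· + ·) h1 h2
  smul_mem' := by
    rintro c ⟨u, g⟩ ⟨φ, q, hφ, e1, m, hq, eq, e2, a, b⟩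
    have acq : IsAC 0 q := by simpa [IsAC] using hq
    refine ⟨_, _, hφ.const_mul c, ?_, ?_, hq.const_mul c, ?_, ?_, by simp [a], by simp [b]⟩
    · filter_upwards [Lp.coeFn_smul c u, e1] with x h h1
      change (c • u) x = _
      rw [h, Pi.smul_apply, smul_eq_mul]
      exact congrArg (c * ·) h1
    · refine (memLp_congr_ae ?_).1 (m.const_mul c)
      filter_upwards [hφ.ae_differentiableAt] with x d
      rw [deriv_const_mul c d, mul_left_comm]
    · filter_upwards [eq, hφ.ae_differentiableAt] with x h1 d
      rw [h1, deriv_const_mul c d, mul_left_comm]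
    · filter_upwards [Lp.coeFn_smul c g, e2, acq.ae_differentiableAt] with x h h1 d
      change (c • g) x = _
      rw [h, Pi.smul_apply, smul_eq_mul, deriv_const_mul c d]
      exact congrArg (c * ·) h1

theorem ellGraph_functional (α : ℝ) (z : L2I × L2I) (hz : z ∈ ellGraph α) (h0 : z.1 = 0) :
    z.2 = 0 := by
  obtain ⟨φ, q, hφ, e1, -, hq, eq, e2, -, -⟩ := hz
  rw [h0] at e1
  have e3 := eqOn_of_ae hφ.continuousOn continuousOn_const
    (e1.symm.trans (Lp.coeFn_zero ℝ 2 (volume.restrict (Ioo (0 : ℝ) 1))))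
  have acq : IsAC 0 q := by simpa [IsAC] using hq
  have e4 : EqOn q (fun _ => 0) (Ioo 0 1) := by
    refine eqOn_of_ae acq.continuousOn continuousOn_const ?_
    filter_upwards [eq, ae_mem] with x hx hx1
    rw [hx, deriv_eq_of_eqOn e3 hx1]
    simp
  apply Lp.ext
  filter_upwards [e2, ae_mem, Lp.coeFn_zero ℝ 2 (volume.restrict (Ioo (0 : ℝ) 1))] with x hx hx1 hx2
  rw [hx, hx2, deriv_eq_of_eqOn e4 hx1]
  simp

/-- The operator `A u = (x^α u_x)_x` in `L²(0,1)`, with domain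
`D(A) = {u ∈ H²_α(0,1) : (x^α u_x)(0) = 0, u_x(1) = 0}`. -/
def ell (α : ℝ) : L2I →ₗ.[ℝ] L2I := (ellGraph α).toLinearPMap

theorem ell_graph (α : ℝ) : (ell α).graph = ellGraph α :=
  Submodule.toLinearPMap_graph_eq _ (ellGraph_functional α)

/-! ### The first-order system -/

/-- The state space `H¹_α(0,1) × L²(0,1)`, with its product norm. -/
abbrev State (α : ℝ) : Type := WithLp 2 (H1 α × L2I)

/-- The wave operator `(w₀, w₁) ↦ (w₁, A w₀)` in the state space, with domain
`D(A) × H¹_α(0,1)`. -/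
def waveOp (α : ℝ) : State α →ₗ.[ℝ] State α where
  domain :=
    { carrier := {W | W.fst.val ∈ (ell α).domain ∧ W.snd ∈ (wgrad α).domain}
      zero_mem' := ⟨(ell α).domain.zero_mem, (wgrad α).domain.zero_mem⟩
      add_mem' := fun h h' =>
        ⟨(ell α).domain.add_mem h.1 h'.1, (wgrad α).domain.add_mem h.2 h'.2⟩
      smul_mem' := fun c _ h =>
        ⟨(ell α).domain.smul_mem c h.1, (wgrad α).domain.smul_mem c h.2⟩ }
  toFun :=
    { toFun := fun W => WithLp.toLp 2
        (GraphSpace.mk W.1.snd W.2.2, ell α ⟨W.1.fst.val, W.2.1⟩)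
      map_add' := fun W W' => congrArg (WithLp.toLp 2) (Prod.ext (by rfl)
        ((ell α).map_add ⟨W.1.fst.val, W.2.1⟩ ⟨W'.1.fst.val, W'.2.1⟩))
      map_smul' := fun c W => congrArg (WithLp.toLp 2) (Prod.ext (by rfl)
        ((ell α).map_smul c ⟨W.1.fst.val, W.2.1⟩)) }

/-- The domain `D(A) × H¹_α(0,1)` of the wave operator, with its graph norm. -/
abbrev DWave (α : ℝ) : Type := GraphSpace (waveOp α)

/-- The class of admissible potentials: `H¹_α(0,1)` if `α < 1`, and
`{μ ∈ H¹_α(0,1) : x^{α/2} μ_x ∈ L^∞(0,1)}` if `1 ≤ α`. -/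
def V1 (α : ℝ) : Set (H1 α) :=
  {μ | 1 ≤ α → MemLp μ.image ∞ (volume.restrict (Ioo (0 : ℝ) 1))}

/-- Representatives of an element of `H¹_α(0,1)` and of its weighted derivative. -/
theorem H1.exists_rep {α : ℝ} (u : H1 α) : ∃ φ : ℝ → ℝ, IsAC α φ ∧
    u.val =ᵐ[volume.restrict (Ioo (0 : ℝ) 1)] φ ∧
    u.image =ᵐ[volume.restrict (Ioo (0 : ℝ) 1)] fun x => x ^ (α / 2) * deriv φ x := by
  have h : ((u.val, u.image) : L2I × L2I) ∈ (wgrad α).graph := (wgrad α).mem_graph u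
  rw [wgrad_graph] at h
  exact h

/-- For `α < 1` every function of the class `IsAC α` is bounded on `(0,1)`. -/
theorem IsAC.bounded_of_lt {α : ℝ} (hα : α < 1) {φ : ℝ → ℝ} (h : IsAC α φ) :
    ∃ C, ∀ x ∈ Ioo (0 : ℝ) 1, |φ x| ≤ C := by
  rw [IsAC, if_pos hα] at h
  obtain ⟨C, hC⟩ := h.exists_bound
  refine ⟨C, fun x hx => hC x ?_⟩
  rw [uIcc_of_le zero_le_one]
  exact Ioo_subset_Icc_self hx

/-- For `α < 2`, a locally absolutely continuous function with `x^{α/2} φ'` essentially bounded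
is bounded on `(0,1)`. -/
theorem IsAC.bounded_of_deriv {α : ℝ} (hα : α < 2) {φ : ℝ → ℝ} (h : IsAC α φ)
    (hb : MemLp (fun x => x ^ (α / 2) * deriv φ x) ∞ (volume.restrict (Ioo (0 : ℝ) 1))) :
    ∃ C, ∀ x ∈ Ioo (0 : ℝ) 1, |φ x| ≤ C := by
  obtain ⟨M, hM⟩ : ∃ M : ℝ, ∀ᵐ x ∂(volume.restrict (Ioo (0 : ℝ) 1)),
      ‖x ^ (α / 2) * deriv φ x‖ ≤ M := by
    have h2 := hb.2
    rw [eLpNorm_exponent_top] at h2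
    refine ⟨(eLpNormEssSup (fun x => x ^ (α / 2) * deriv φ x)
        (volume.restrict (Ioo (0 : ℝ) 1))).toReal, ?_⟩
    filter_upwards [enorm_ae_le_eLpNormEssSup (fun x => x ^ (α / 2) * deriv φ x)
      (volume.restrict (Ioo (0 : ℝ) 1))] with x hx
    have h3 := ENNReal.toReal_mono h2.ne hx
    rwa [toReal_enorm] at h3
  have hint : IntegrableOn (fun x : ℝ => M * x ^ (-(α / 2))) (Ioo 0 1) := by
    refine Integrable.const_mul ?_ M
    exact (intervalIntegral.integrableOn_Ioo_rpow_iff one_pos).2 (by linarith)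
  refine ⟨|φ 1| + ∫ x in Ioo (0 : ℝ) 1, ‖M * x ^ (-(α / 2))‖, fun x hx => ?_⟩
  have hsub : Ioo x 1 ⊆ Ioo 0 1 := Ioo_subset_Ioo_left hx.1.le
  have h1 := (h.local hx).integral_deriv_eq_sub
  have h2 : |∫ t in x..1, deriv φ t| ≤ ∫ x in Ioo (0 : ℝ) 1, ‖M * x ^ (-(α / 2))‖ := by
    rw [intervalIntegral.integral_of_le hx.2.le, integral_Ioc_eq_integral_Ioo]
    have h4 : ∫ t in Ioo x 1, ‖M * t ^ (-(α / 2))‖ ≤ ∫ t in Ioo (0 : ℝ) 1, ‖M * t ^ (-(α / 2))‖ :=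
      setIntegral_mono_set hint.norm (ae_of_all _ fun _ => norm_nonneg _) (ae_of_all _ hsub)
    have hint' : IntegrableOn (fun x : ℝ => M * x ^ (-(α / 2))) (Ioo x 1) := hint.mono_set hsub
    rw [← Real.norm_eq_abs]
    refine (norm_integral_le_of_norm_le hint'.norm ?_).trans h4
    filter_upwards [ae_mono (Measure.restrict_mono hsub le_rfl) hM,
      ae_restrict_mem measurableSet_Ioo] with t ht htm
    have ht0 : 0 < t := hx.1.trans htm.1
    have hp : 0 < t ^ (-(α / 2)) := Real.rpow_pos_of_pos ht0 _
    have e : deriv φ t = t ^ (-(α / 2)) * (t ^ (α / 2) * deriv φ t) := by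
      rw [← mul_assoc, ← Real.rpow_add ht0]
      simp
    rw [e, norm_mul, norm_mul M, mul_comm, Real.norm_of_nonneg hp.le, Real.norm_eq_abs M]
    exact mul_le_mul_of_nonneg_right (ht.trans (le_abs_self M)) hp.le
  rw [h1] at h2
  have h3 := abs_sub_abs_le_abs_sub (φ x) (φ 1)
  rw [abs_sub_comm] at h3
  linarith

/-- The product of an admissible potential and an element of `H¹_α(0,1)` is in `H¹_α(0,1)`. -/
theorem exists_potMul {α : ℝ} (hα : α < 2) (μ : V1 α) (u : H1 α) :
    ∃ w : H1 α, w.val =ᵐ[volume.restrict (Ioo (0 : ℝ) 1)] fun x => μ.1.val x * u.val x := by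
  obtain ⟨φ, hφ, e1, e2⟩ := H1.exists_rep μ.1
  obtain ⟨ψ, hψ, e3, e4⟩ := H1.exists_rep u
  set ν := volume.restrict (Ioo (0 : ℝ) 1) with hν
  have top_of : ∀ {r : ℝ → ℝ}, IsAC α r → (∃ C, ∀ x ∈ Ioo (0 : ℝ) 1, |r x| ≤ C) →
      MemLp r ∞ ν := by
    rintro r hr ⟨C, hC⟩
    refine memLp_top_of_bound (hr.continuousOn.aestronglyMeasurable measurableSet_Ioo) C ?_
    filter_upwards [ae_mem] with x hx using hC x hx
  have bφ : MemLp φ ∞ ν := by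
    refine top_of hφ ?_
    by_cases h1 : α < 1
    · exact hφ.bounded_of_lt h1
    · exact hφ.bounded_of_deriv hα ((memLp_congr_ae e2).1 (μ.2 (not_lt.1 h1)))
  have m1 : MemLp (fun x => φ x * ψ x) 2 ν := ((memLp_congr_ae e3).1 (Lp.memLp u.val)).mul bφ
  have m2 : MemLp (fun x => φ x * (x ^ (α / 2) * deriv ψ x)) 2 ν :=
    ((memLp_congr_ae e4).1 (Lp.memLp u.image)).mul bφ
  have m3 : MemLp (fun x => (x ^ (α / 2) * deriv φ x) * ψ x) 2 ν := by
    by_cases h1 : α < 1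
    · exact (top_of hψ (hψ.bounded_of_lt h1)).mul ((memLp_congr_ae e2).1 (Lp.memLp μ.1.image))
    · exact ((memLp_congr_ae e3).1 (Lp.memLp u.val)).mul
        ((memLp_congr_ae e2).1 (μ.2 (not_lt.1 h1)))
  have hmem : ((m1.toLp _, (m3.add m2).toLp _) : L2I × L2I) ∈ (wgrad α).graph := by
    rw [wgrad_graph]
    refine ⟨_, hφ.mul hψ, m1.coeFn_toLp, ?_⟩
    filter_upwards [(m3.add m2).coeFn_toLp, hφ.ae_differentiableAt, hψ.ae_differentiableAt]
      with x h d d'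
    rw [h, Pi.add_apply, deriv_fun_mul d d']
    ring
  refine ⟨GraphSpace.mk _ (LinearPMap.mem_domain_of_mem_graph hmem), ?_⟩
  filter_upwards [m1.coeFn_toLp, e1, e3] with x h h1 h3
  change (m1.toLp _ : L2I) x = _
  rw [h, h1, h3]

/-- Multiplication `u ↦ μ u` by an admissible potential, as a map of `H¹_α(0,1)` to itself. -/
def potMul {α : ℝ} (hα : α < 2) (μ : V1 α) (u : H1 α) : H1 α := (exists_potMul hα μ u).choose

theorem potMul_spec {α : ℝ} (hα : α < 2) (μ : V1 α) (u : H1 α) :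
    (potMul hα μ u).val =ᵐ[volume.restrict (Ioo (0 : ℝ) 1)] fun x => μ.1.val x * u.val x :=
  (exists_potMul hα μ u).choose_spec

/-- The element of `H¹_α(0,1)` underlying the first component `w₀` of `(w₀, w₁) ∈ D(A) × H¹_α`. -/
def DWave.fst {α : ℝ} (W : DWave α) : H1 α := W.val.fst

/-- The map `h ↦ (0, h)` from `H¹_α(0,1)` to `D(A) × H¹_α(0,1)`. -/
def DWave.inr {α : ℝ} (h : H1 α) : DWave α :=
  GraphSpace.mk (WithLp.toLp 2 (0, h.val)) ⟨(ell α).domain.zero_mem, h.2⟩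

/-- The operator `(w₀, w₁) ↦ (0, μ w₀)` on `D(A) × H¹_α(0,1)`. -/
def potOp {α : ℝ} (hα : α < 2) (μ : V1 α) (W : DWave α) : DWave α :=
  DWave.inr (potMul hα μ W.fst)

/-- The integrand `s ↦ e^{(t-s)𝒜} (p(s) ℬ W(s) + (0, f(s)))` of the Duhamel formula at time `t`,
with values in `D(A) × H¹_α(0,1)`; only `0 < s < t` matters. -/
def duhamelIntegrand {α : ℝ} (hα : α < 2) {S : C0Semigroup (State α)}
    (hS : S.IsGeneratedBy (waveOp α)) {T : ℝ} (hT : 0 < T) (p : ℝ → ℝ) (μ : V1 α) (f : ℝ → H1 α)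
    (W : C(Icc 0 T, DWave α)) (t s : ℝ) : DWave α :=
  S.onDomain hS (t - s).toNNReal
    (p s • potOp hα μ (W (projIcc 0 T hT.le s)) + DWave.inr (f s))

/-- `W ∈ C⁰([0,T], D(𝒜))` is a classical solution of
`W' = 𝒜 W + p ℬ W + (0, f)`, `W(0) = W₀`: the Duhamel formula
`W(t) = e^{t𝒜} W₀ + ∫₀ᵗ e^{(t-s)𝒜} (p(s) ℬ W(s) + (0, f(s))) ds`
holds in `D(𝒜)` (the integral being a convergent Bochner integral in this space)
for every `t ∈ [0,T]`. -/
def IsClassicalSolution {α : ℝ} (hα : α < 2) {S : C0Semigroup (State α)}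
    (hS : S.IsGeneratedBy (waveOp α)) {T : ℝ} (hT : 0 < T) (p : ℝ → ℝ) (μ : V1 α) (f : ℝ → H1 α)
    (W₀ : DWave α) (W : C(Icc 0 T, DWave α)) : Prop :=
  ∀ t : Icc 0 T,
    IntervalIntegrable (duhamelIntegrand hα hS hT p μ f W t) volume 0 t ∧
    W t = S.onDomain hS (t : ℝ).toNNReal W₀ +
      ∫ s in (0 : ℝ)..t, duhamelIntegrand hα hS hT p μ f W t s

end DegenerateWave

end

open DegenerateWave

/-!
The energy of a state `(w₀, w₁)` is its squared norm in `H¹_α × L²`. Since `A` is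
`-∫ x^α u_x v_x` in weak form, the wave operator `𝒜` is skew-symmetric for the scalar product of
the state space, except for the bounded term `∫ w₀ w₁`; hence `⟨𝒜 W, W⟩ ≤ ‖W‖²`
(`quasiDissipative_waveOp`). The equation `c W - 𝒜 W = Z` reduces to `c² u - A u = f`, which
Lax–Milgram solves in `H¹_α` (`exists_waveOp_resolvent`). So `𝒜` is maximal quasi-dissipative, and
the Yosida approximation gives its semigroup (`QuasiDissipative.exists_semigroup`).

The analysis special to the degenerate weight is in two facts.
* `H¹_α` is complete: evaluating `-∫ₓ¹ s^{-α/2} g(s) ds` at an interior point is a bounded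
  functional of `g ∈ L²`, so that the relation `x^{α/2} u_x = g` is closed (`isClosed_gradGraph`).
* `A` is the operator of the form `-∫ x^α u_x v_x` on `H¹_α` (`mem_ell_graph_iff`). The boundary
  term `x^α u_x v` at `0` vanishes for every `α`: it has a limit, and it cannot be a nonzero one
  because `x^α u_x = O(√x)` while `v ∈ L²` (`inner_ell_eq`). Conversely, a weak solution satisfies
  the boundary conditions because constants, and functions constant near `0`, are admissible tests
  (`mem_ellGraph_of_weak`).

The semigroup leaves `D(𝒜)` invariant and is strongly continuous there for the graph norm. The
perturbation `ℬ` is bounded in `D(𝒜)`, because multiplication by `μ` is bounded in `H¹_α`: it is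
everywhere defined and has a closed graph (`continuous_potMul`). The Duhamel formula is thus a
linear Volterra equation in `D(𝒜)`. After multiplication by `e^{-κt}` with `κ` large
its integral operator has norm at most `1/2` in `C⁰([0,T], D(𝒜))`, by Young's inequality and
`p ∈ L²`; existence, uniqueness and the estimate follow at once (`wellPosed`).
-/

noncomputable section

namespace DegenerateWave

/-! ### Generation of semigroups by maximal quasi-dissipative operators -/

section HilleYosida

variable {X : Type*} [NormedAddCommGroup X] [InnerProductSpace ℝ X]

theorem norm_exp_le [CompleteSpace X] (B : X →L[ℝ] X) :
    ‖NormedSpace.exp B‖ ≤ Real.exp ‖B‖ := by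
  rw [NormedSpace.exp_eq_tsum ℝ]
  refine tsum_of_norm_bounded (g := fun n : ℕ => (n.factorial : ℝ)⁻¹ • ‖B‖ ^ n) ?_ fun n => ?_
  · rw [Real.exp_eq_exp_ℝ]
    exact NormedSpace.exp_series_hasSum_exp' (𝕂 := ℝ) ‖B‖
  · rw [norm_smul, norm_inv, Real.norm_natCast, smul_eq_mul]
    gcongr
    cases n with
    | zero =>
      rw [pow_zero, pow_zero]
      exact ContinuousLinearMap.norm_id_le
    | succ n => exact norm_pow_le' _ n.succ_pos

/-- The Yosida approximation `c² R - c` of `A`, where `R = (c - A)⁻¹` has `‖R‖ ≤ (c - ω)⁻¹`,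
generates a semigroup of growth at most `c ω / (c - ω) ≤ 2 ω`, since `c ≥ 2 ω`. -/
theorem norm_exp_yosida_le [CompleteSpace X] {R : X →L[ℝ] X} {c ω : ℝ} (hω : 0 ≤ ω)
    (hc0 : 0 < c) (hc : 2 * ω ≤ c) (hR : ‖R‖ ≤ (c - ω)⁻¹) {t : ℝ} (ht : 0 ≤ t) :
    ‖NormedSpace.exp (t • (c ^ 2 • R - c • (1 : X →L[ℝ] X)))‖ ≤ Real.exp (2 * ω * t) := by
  have hcω : 0 < c - ω := by linarith
  have e1 : t • (c ^ 2 • R - c • (1 : X →L[ℝ] X)) =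
      (t * c ^ 2) • R + algebraMap ℝ (X →L[ℝ] X) (-(t * c)) := by
    rw [Algebra.algebraMap_eq_smul_one]
    module
  -- lemmas on exponentials of commuting elements are stated over `ℚ`
  let : NormedAlgebra ℚ (X →L[ℝ] X) := NormedAlgebra.restrictScalars ℚ ℝ (X →L[ℝ] X)
  rw [e1, NormedSpace.exp_add_of_commute (Algebra.commutes' _ _).symm,
    ← NormedSpace.algebraMap_exp_comm, ← Real.exp_eq_exp_ℝ, Algebra.algebraMap_eq_smul_one,
    mul_smul_comm, mul_one, norm_smul, Real.norm_of_nonneg (Real.exp_pos _).le]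
  have h1 : ‖(t * c ^ 2) • R‖ ≤ t * c ^ 2 * (c - ω)⁻¹ := by
    rw [norm_smul, Real.norm_of_nonneg (by positivity)]
    gcongr
  have h2 : ‖NormedSpace.exp ((t * c ^ 2) • R)‖ ≤ Real.exp (t * c ^ 2 * (c - ω)⁻¹) :=
    (norm_exp_le _).trans (Real.exp_le_exp.2 h1)
  refine (mul_le_mul_of_nonneg_left h2 (Real.exp_pos _).le).trans ?_
  rw [← Real.exp_add, Real.exp_le_exp]
  have h3 : -(t * c) + t * c ^ 2 * (c - ω)⁻¹ = t * (c * ω * (c - ω)⁻¹) := by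
    field_simp
    ring
  have h4 : c * ω * (c - ω)⁻¹ ≤ 2 * ω := by
    rw [← div_eq_mul_inv, div_le_iff₀ hcω]
    nlinarith
  rw [h3]
  nlinarith [mul_le_mul_of_nonneg_left h4 ht]

variable {A : X →ₗ.[ℝ] X} {ω : ℝ}

/-- The numerical range of `A` lies in `(-∞, ω]`: one has `⟨A x, x⟩ ≤ ω ‖x‖²` on the domain,
i.e. `A - ω` is dissipative. -/
def QuasiDissipative (A : X →ₗ.[ℝ] X) (ω : ℝ) : Prop :=
  ∀ x y : X, (x, y) ∈ A.graph → inner ℝ y x ≤ ω * ‖x‖ ^ 2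

theorem QuasiDissipative.norm_le (hA : QuasiDissipative A ω) {x y : X} (h : (x, y) ∈ A.graph)
    (c : ℝ) : (c - ω) * ‖x‖ ≤ ‖c • x - y‖ := by
  rcases (norm_nonneg x).eq_or_lt with h0 | h0
  · rw [← h0, mul_zero]
    exact norm_nonneg _
  · have h1 := real_inner_le_norm (c • x - y) x
    rw [inner_sub_left, real_inner_smul_left, real_inner_self_eq_norm_sq] at h1
    refine le_of_mul_le_mul_right ?_ h0
    nlinarith [hA x y h]

/-- The resolvent `R = (c - A)⁻¹` of a maximal quasi-dissipative operator. It is described through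
the graph of `A`, by `A (R z) = c R z - z` and `R (c x - A x) = x`. -/
theorem QuasiDissipative.exists_resolvent (hA : QuasiDissipative A ω) {c : ℝ} (hc : ω < c)
    (hr : ∀ z : X, ∃ x y, (x, y) ∈ A.graph ∧ c • x - y = z) :
    ∃ R : X →L[ℝ] X, ‖R‖ ≤ (c - ω)⁻¹ ∧ (∀ z, (R z, c • R z - z) ∈ A.graph) ∧
      ∀ x y, (x, y) ∈ A.graph → R (c • x - y) = x := by
  have hcω : 0 < c - ω := sub_pos.2 hc
  choose r s hrs e using hr
  have uniq : ∀ x y, (x, y) ∈ A.graph → r (c • x - y) = x := by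
    intro x y hxy
    have h1 := A.graph.sub_mem (hrs (c • x - y)) hxy
    have h2 := hA.norm_le h1 c
    have h3 : c • (r (c • x - y) - x) - (s (c • x - y) - y) = 0 := by
      have := e (c • x - y)
      rw [smul_sub]
      rw [← sub_eq_zero] at this
      rw [← this]
      abel
    rw [h3, norm_zero] at h2
    have h4 : ‖r (c • x - y) - x‖ = 0 :=
      le_antisymm (nonpos_of_mul_nonpos_right h2 hcω) (norm_nonneg _)
    exact sub_eq_zero.1 (norm_eq_zero.1 h4)
  let L : X →ₗ[ℝ] X :=
    { toFun := r
      map_add' := fun z w => by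
        have h := uniq _ _ (A.graph.add_mem (hrs z) (hrs w))
        have h2 : c • (r z + r w) - (s z + s w) = z + w := by
          conv_rhs => rw [← e z, ← e w]
          module
        rwa [h2] at h
      map_smul' := fun a z => by
        have h := uniq _ _ (A.graph.smul_mem a (hrs z))
        have h2 : c • (a • r z) - a • s z = a • z := by
          conv_rhs => rw [← e z]
          module
        rwa [h2] at h }
  have hL : ∀ z, ‖L z‖ ≤ (c - ω)⁻¹ * ‖z‖ := by
    intro z
    have h := hA.norm_le (hrs z) c
    rw [e z] at h
    rw [← div_eq_inv_mul, le_div_iff₀ hcω, mul_comm]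
    exact h
  refine ⟨L.mkContinuous _ hL, L.mkContinuous_norm_le (inv_nonneg.2 hcω.le) hL, fun z => ?_, uniq⟩
  have h := hrs z
  have h2 : s z = c • r z - z := by
    rw [eq_sub_iff_add_eq, ← eq_sub_iff_add_eq', e z]
  rwa [h2] at h

/-- A maximal quasi-dissipative operator is densely defined: a vector orthogonal to the domain
is of the form `c x - A x`, and pairing it with `x` gives `x = 0`. -/
theorem QuasiDissipative.dense_domain [CompleteSpace X] (hA : QuasiDissipative A ω) {c : ℝ}
    (hc : ω < c) (hr : ∀ z : X, ∃ x y, (x, y) ∈ A.graph ∧ c • x - y = z) :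
    Dense (A.domain : Set X) := by
  rw [Submodule.dense_iff_topologicalClosure_eq_top, Submodule.topologicalClosure_eq_top_iff,
    Submodule.eq_bot_iff]
  intro z hz
  obtain ⟨x, y, hxy, rfl⟩ := hr z
  have h1 := (Submodule.mem_orthogonal' _ _).1 hz x (LinearPMap.mem_domain_of_mem_graph hxy)
  rw [inner_sub_left, real_inner_smul_left, real_inner_self_eq_norm_sq] at h1
  have h2 := hA x y hxy
  have h3 : ‖x‖ ^ 2 = 0 := by nlinarith [sq_nonneg ‖x‖]
  have h4 : x = 0 := by simpa using h3
  rw [h4, A.graph_fst_eq_zero_snd hxy h4]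
  simp

/-- The exponentials of two commuting bounded operators, compared on a vector: the derivative of
`s ↦ exp ((t - s) B') exp (s B) x` is `exp ((t - s) B') exp (s B) (B x - B' x)`. -/
theorem norm_exp_sub_exp_le [CompleteSpace X] {B B' : X →L[ℝ] X} (hBB : Commute B B') {κ : ℝ}
    (hB : ∀ t : ℝ, 0 ≤ t → ‖NormedSpace.exp (t • B)‖ ≤ Real.exp (κ * t))
    (hB' : ∀ t : ℝ, 0 ≤ t → ‖NormedSpace.exp (t • B')‖ ≤ Real.exp (κ * t)) {t : ℝ} (ht : 0 ≤ t)
    (x : X) :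
    ‖NormedSpace.exp (t • B) x - NormedSpace.exp (t • B') x‖ ≤
      Real.exp (κ * t) * ‖B x - B' x‖ * t := by
  let E : ℝ → X →L[ℝ] X := fun s => NormedSpace.exp (s • B)
  let E' : ℝ → X →L[ℝ] X := fun s => NormedSpace.exp (s • B')
  have hE : ∀ s, HasDerivAt E (E s * B) s := fun s => hasDerivAt_exp_smul_const B s
  have hE' : ∀ s, HasDerivAt E' (E' s * B') s := fun s => hasDerivAt_exp_smul_const B' s
  have hc : ∀ s, Commute B' (E s) := fun s => by
    let : NormedAlgebra ℚ (X →L[ℝ] X) := NormedAlgebra.restrictScalars ℚ ℝ (X →L[ℝ] X)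
    exact (hBB.symm.smul_right s).exp_right
  have hd : ∀ s, HasDerivAt (fun s => (E' (t - s) * E s) x) ((E' (t - s) * E s) (B x - B' x)) s := by
    intro s
    have h1 : HasDerivAt (fun s => E' (t - s)) (-(E' (t - s) * B')) s := by
      simpa [Function.comp_def] using (hE' (t - s)).scomp s ((hasDerivAt_id s).const_sub t)
    have h2 := ((h1.mul (hE s)).clm_apply (hasDerivAt_const s x))
    have h3 : -(E' (t - s) * B') * E s + E' (t - s) * (E s * B) = E' (t - s) * E s * (B - B') := by
      rw [neg_mul, mul_assoc, (hc s).eq, mul_sub]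
      noncomm_ring
    rw [h3, map_zero, add_zero, mul_apply_eq_comp _ (B - B')] at h2
    exact h2
  have h := norm_image_sub_le_of_norm_deriv_le_segment' (a := 0) (b := t)
    (C := Real.exp (κ * t) * ‖B x - B' x‖) (fun s _ => (hd s).hasDerivWithinAt) ?_ t ⟨ht, le_rfl⟩
  · simpa [E, E'] using h
  · intro s hs
    refine (ContinuousLinearMap.le_opNorm _ _).trans ?_
    gcongr
    refine (norm_mul_le _ _).trans ((mul_le_mul (hB' _ (sub_nonneg.2 hs.2.le)) (hB s hs.1)
      (norm_nonneg _) (Real.exp_pos _).le).trans ?_)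
    rw [← Real.exp_add, ← mul_add, sub_add_cancel]

/-- If commuting bounded operators `B n` have uniformly exponentially bounded exponentials and
converge on a dense set, then `exp (t B n) x` is uniformly Cauchy for `t` in bounded intervals. -/
theorem uniformCauchy_exp [CompleteSpace X] {B : ℕ → X →L[ℝ] X}
    (hBB : ∀ m n, Commute (B m) (B n)) {κ : ℝ} (hκ : 0 ≤ κ)
    (hB : ∀ n, ∀ t : ℝ, 0 ≤ t → ‖NormedSpace.exp (t • B n)‖ ≤ Real.exp (κ * t))
    (hd : Dense {x : X | CauchySeq fun n => B n x}) (T : ℝ) (x : X) :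
    UniformCauchySeqOn (fun n (t : ℝ) => NormedSpace.exp (t • B n) x) atTop (Icc 0 T) := by
  rw [Metric.uniformCauchySeqOn_iff]
  intro ε hε
  rcases lt_or_ge T 0 with hT | hT
  · exact ⟨0, fun _ _ _ _ t ht => absurd (ht.1.trans ht.2) (not_le.2 hT)⟩
  set M := Real.exp (κ * T) with hM
  have hM0 : 0 < M := Real.exp_pos _
  obtain ⟨y, hy, hxy⟩ := hd.exists_dist_lt x (ε := ε / (4 * M)) (by positivity)
  obtain ⟨N, hN⟩ := Metric.cauchySeq_iff.1 hy (ε / (2 * (M * (T + 1)))) (by positivity)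
  refine ⟨N, fun m hm n hn t ht => ?_⟩
  have hMt : Real.exp (κ * t) ≤ M := Real.exp_le_exp.2 (mul_le_mul_of_nonneg_left ht.2 hκ)
  have h1 : ∀ k, ‖NormedSpace.exp (t • B k) (x - y)‖ ≤ M * ‖x - y‖ := fun k =>
    (ContinuousLinearMap.le_opNorm _ _).trans
      (mul_le_mul_of_nonneg_right ((hB k t ht.1).trans hMt) (norm_nonneg _))
  have h2 : ‖NormedSpace.exp (t • B m) y - NormedSpace.exp (t • B n) y‖ ≤
      M * ‖B m y - B n y‖ * (T + 1) := by
    refine (norm_exp_sub_exp_le (hBB m n) (hB m) (hB n) ht.1 y).trans ?_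
    gcongr
    · exact ht.1
    · linarith [ht.2]
  have h3 : M * ‖B m y - B n y‖ * (T + 1) < ε / 2 := by
    have := hN m hm n hn
    rw [dist_eq_norm, lt_div_iff₀ (by positivity)] at this
    linarith
  have h4 : M * ‖x - y‖ < ε / 4 := by
    rw [dist_eq_norm, lt_div_iff₀ (by positivity)] at hxy
    linarith
  rw [dist_eq_norm]
  calc ‖NormedSpace.exp (t • B m) x - NormedSpace.exp (t • B n) x‖
      = ‖NormedSpace.exp (t • B m) (x - y) - NormedSpace.exp (t • B n) (x - y) +
          (NormedSpace.exp (t • B m) y - NormedSpace.exp (t • B n) y)‖ := by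
        rw [map_sub, map_sub]
        congr 1
        abel
    _ ≤ ‖NormedSpace.exp (t • B m) (x - y)‖ + ‖NormedSpace.exp (t • B n) (x - y)‖ +
          ‖NormedSpace.exp (t • B m) y - NormedSpace.exp (t • B n) y‖ :=
        (norm_add_le _ _).trans (add_le_add_left (norm_sub_le _ _) _)
    _ < ε := by linarith [h1 m, h1 n]

/-- The limit of the semigroups `exp (t B n)`, for commuting bounded operators `B n` converging on
a dense set. -/
theorem exists_semigroup_limit [CompleteSpace X] {B : ℕ → X →L[ℝ] X}
    (hBB : ∀ m n, Commute (B m) (B n)) {κ : ℝ} (hκ : 0 ≤ κ)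
    (hB : ∀ n, ∀ t : ℝ, 0 ≤ t → ‖NormedSpace.exp (t • B n)‖ ≤ Real.exp (κ * t))
    (hd : Dense {x : X | CauchySeq fun n => B n x}) :
    ∃ S : C0Semigroup X, (∀ t, ‖S.op t‖ ≤ Real.exp (κ * t)) ∧
      ∀ (T : ℝ) (x : X), TendstoUniformlyOn (fun n (t : ℝ) => NormedSpace.exp (t • B n) x)
        (fun t => S.op t.toNNReal x) atTop (Icc 0 T) := by
  have hC := fun T x => uniformCauchy_exp hBB hκ hB hd T x
  have hlim : ∀ (t : ℝ≥0) (x : X), ∃ y, Tendsto (fun n => NormedSpace.exp ((t : ℝ) • B n) x) atTop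
      (𝓝 y) := fun t x => cauchySeq_tendsto_of_complete ((hC t x).cauchy_map ⟨t.2, le_rfl⟩)
  choose S hS using hlim
  let op : ℝ≥0 → X →L[ℝ] X := fun t =>
    continuousLinearMapOfTendsto (fun n => NormedSpace.exp ((t : ℝ) • B n))
      (tendsto_pi_nhds.2 (hS t))
  have hop : ∀ t x, op t x = S t x := fun t x => rfl
  have hle : ∀ (t : ℝ≥0) (x : X), ‖S t x‖ ≤ Real.exp (κ * t) * ‖x‖ := fun t x =>
    le_of_tendsto (hS t x).norm (Eventually.of_forall fun n =>
      (ContinuousLinearMap.le_opNorm _ _).trans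
        (mul_le_mul_of_nonneg_right (hB n t t.2) (norm_nonneg _)))
  have hunif : ∀ (T : ℝ) (x : X), TendstoUniformlyOn
      (fun n (t : ℝ) => NormedSpace.exp (t • B n) x) (fun t => op t.toNNReal x) atTop (Icc 0 T) := by
    intro T x
    refine (hC T x).tendstoUniformlyOn_of_tendsto fun t ht => ?_
    have := hS t.toNNReal x
    rwa [Real.coe_toNNReal t ht.1] at this
  refine ⟨⟨op, ?_, ?_, ?_⟩, fun t => ContinuousLinearMap.opNorm_le_bound _ (Real.exp_pos _).le
    (hle t), hunif⟩
  · ext x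
    have h := hS 0 x
    simp only [NNReal.coe_zero, zero_smul, NormedSpace.exp_zero] at h
    exact tendsto_nhds_unique h tendsto_const_nhds
  · intro s t
    ext x
    refine tendsto_nhds_unique (hS (s + t) x) ?_
    have h1 : ∀ n, NormedSpace.exp (((s + t : ℝ≥0) : ℝ) • B n) x =
        NormedSpace.exp ((s : ℝ) • B n) (NormedSpace.exp ((t : ℝ) • B n) x - S t x) +
          NormedSpace.exp ((s : ℝ) • B n) (S t x) := by
      intro n
      let : NormedAlgebra ℚ (X →L[ℝ] X) := NormedAlgebra.restrictScalars ℚ ℝ (X →L[ℝ] X)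
      rw [← map_add, sub_add_cancel, NNReal.coe_add, add_smul, NormedSpace.exp_add_of_commute
        (((Commute.refl (B n)).smul_right _).smul_left _)]
      rfl
    simp only [h1]
    have h2 : Tendsto (fun n => NormedSpace.exp ((s : ℝ) • B n)
        (NormedSpace.exp ((t : ℝ) • B n) x - S t x)) atTop (𝓝 0) := by
      have h3 : Tendsto (fun n => Real.exp (κ * s) * ‖NormedSpace.exp ((t : ℝ) • B n) x - S t x‖)
          atTop (𝓝 0) := by
        have h4 : Tendsto (fun n => NormedSpace.exp ((t : ℝ) • B n) x - S t x) atTop (𝓝 0) := by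
          simpa using (hS t x).sub_const (S t x)
        simpa using h4.norm.const_mul (Real.exp (κ * s))
      refine squeeze_zero_norm (fun n => ?_) h3
      exact (ContinuousLinearMap.le_opNorm _ _).trans
        (mul_le_mul_of_nonneg_right (hB n s s.2) (norm_nonneg _))
    have h5 := h2.add (hS s (S t x))
    rw [zero_add] at h5
    exact h5
  · intro x
    rw [continuous_iff_continuousAt]
    intro t
    have h1 : ContinuousOn (fun s : ℝ => op s.toNNReal x) (Icc 0 (t + 1)) := by
      refine (hunif (t + 1) x).continuousOn (Eventually.of_forall fun n => ?_).frequently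
      have : Continuous fun s : ℝ => NormedSpace.exp (s • B n) :=
        continuous_iff_continuousAt.2 fun s => (hasDerivAt_exp_smul_const (B n) s).continuousAt
      exact (this.clm_apply continuous_const).continuousOn
    have h2 : ContinuousWithinAt (fun s : ℝ≥0 => op (s : ℝ).toNNReal x) (Iic (t + 1)) t :=
      ContinuousWithinAt.comp (t := Icc 0 ((t : ℝ) + 1)) (h1 t ⟨t.2, by linarith⟩)
        NNReal.continuous_coe.continuousWithinAt fun s hs => ⟨s.2, by exact_mod_cast hs⟩
    simp only [Real.toNNReal_coe] at h2
    exact h2.continuousAt (Iic_mem_nhds (by simp))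

/-- The limit of the semigroups `exp (t B n)` is differentiable from the right at `0` along every
vector on which the `B n` converge. -/
theorem tendsto_slope_of_exp_limit [CompleteSpace X] {B : ℕ → X →L[ℝ] X} {κ : ℝ} (hκ : 0 ≤ κ)
    (hB : ∀ n, ∀ t : ℝ, 0 ≤ t → ‖NormedSpace.exp (t • B n)‖ ≤ Real.exp (κ * t))
    {S : C0Semigroup X}
    (hS : ∀ (T : ℝ) (x : X), TendstoUniformlyOn (fun n (t : ℝ) => NormedSpace.exp (t • B n) x)
        (fun t => S.op t.toNNReal x) atTop (Icc 0 T))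
    {x y : X} (hxy : Tendsto (fun n => B n x) atTop (𝓝 y)) :
    Tendsto (fun h : ℝ≥0 => (h : ℝ)⁻¹ • (S.op h x - x)) (𝓝[>] 0) (𝓝 y) := by
  rw [Metric.tendsto_nhdsWithin_nhds]
  intro ε hε
  have hy : Tendsto (fun h => S.op h y) (𝓝 0) (𝓝 y) := by
    have := (S.continuous_orbit y).tendsto 0
    rwa [S.op_zero] at this
  obtain ⟨δ, hδ, hSy⟩ := Metric.tendsto_nhds_nhds.1 hy (ε / 4) (by positivity)
  refine ⟨δ, hδ, fun {h} hh hhδ => ?_⟩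
  have hh0 : (0 : ℝ) < h := NNReal.coe_pos.2 hh
  have hhδ' : (h : ℝ) < δ := by
    simpa [NNReal.dist_eq] using hhδ
  set M := Real.exp (κ * h)
  have hM0 : 0 < M := Real.exp_pos _
  have ev1 : ∀ᶠ n in atTop, ‖B n x - y‖ < ε / (4 * M) := by
    filter_upwards [Metric.tendsto_nhds.1 hxy (ε / (4 * M)) (by positivity)] with n hn
    rwa [dist_eq_norm] at hn
  have ev2 := Metric.tendstoUniformlyOn_iff.1 (hS h y) (ε / 4) (by positivity)
  have hlim : Tendsto (fun n => ‖NormedSpace.exp ((h : ℝ) • B n) x - x - (h : ℝ) • y‖) atTop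
      (𝓝 ‖S.op h x - x - (h : ℝ) • y‖) := by
    have := (hS h x).tendsto_at ⟨hh0.le, le_rfl⟩
    rw [Real.toNNReal_coe] at this
    exact ((this.sub_const x).sub_const _).norm
  have hle : ‖S.op h x - x - (h : ℝ) • y‖ ≤ (3 * ε / 4) * h := by
    refine le_of_tendsto hlim ?_
    filter_upwards [ev1, ev2] with n h1 h2
    have hd : ∀ s : ℝ, HasDerivAt (fun s : ℝ => NormedSpace.exp (s • B n) x - s • y)
        (NormedSpace.exp (s • B n) (B n x) - y) s := fun s => by
      have e1 := (hasDerivAt_exp_smul_const (B n) s).clm_apply (hasDerivAt_const s x)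
      have e2 := e1.sub ((hasDerivAt_id s).smul_const y)
      rw [map_zero, add_zero, one_smul, mul_apply_eq_comp] at e2
      exact e2
    have hmv := norm_image_sub_le_of_norm_deriv_le_segment' (a := 0) (b := (h : ℝ))
      (C := 3 * ε / 4) (fun s _ => (hd s).hasDerivWithinAt) ?_ h ⟨hh0.le, le_rfl⟩
    · have e3 : NormedSpace.exp ((h : ℝ) • B n) x - x - (h : ℝ) • y =
          NormedSpace.exp ((h : ℝ) • B n) x - (h : ℝ) • y -
            (NormedSpace.exp ((0 : ℝ) • B n) x - (0 : ℝ) • y) := by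
        rw [zero_smul, NormedSpace.exp_zero, zero_smul, sub_zero, one_apply_eq_self]
        abel
      rw [e3]
      simpa using hmv
    · intro s hs
      have e4 : ‖NormedSpace.exp (s • B n) (B n x - y)‖ ≤ ε / 4 := by
        refine (ContinuousLinearMap.le_of_opNorm_le _ (hB n s hs.1) _).trans ?_
        have : Real.exp (κ * s) ≤ M := Real.exp_le_exp.2 (mul_le_mul_of_nonneg_left hs.2.le hκ)
        refine (mul_le_mul this h1.le (norm_nonneg _) hM0.le).trans (le_of_eq ?_)
        field_simp
      have e5 := h2 s ⟨hs.1, hs.2.le⟩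
      have e6 : ‖S.op s.toNNReal y - y‖ < ε / 4 := by
        rw [← dist_eq_norm]
        refine hSy ?_
        rw [NNReal.dist_eq, NNReal.coe_zero, sub_zero, Real.coe_toNNReal s hs.1,
          abs_of_nonneg hs.1]
        exact hs.2.trans hhδ'
      rw [dist_comm, dist_eq_norm] at e5
      have e7 : NormedSpace.exp (s • B n) (B n x) - y = NormedSpace.exp (s • B n) (B n x - y) +
          (NormedSpace.exp (s • B n) y - S.op s.toNNReal y) + (S.op s.toNNReal y - y) := by
        rw [map_sub]
        abel
      rw [e7]
      refine (norm_add₃_le).trans ?_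
      linarith
  have e8 : (h : ℝ)⁻¹ • (S.op h x - x) - y = (h : ℝ)⁻¹ • (S.op h x - x - (h : ℝ) • y) := by
    rw [smul_sub _ _ ((h : ℝ) • y), inv_smul_smul₀ hh0.ne']
  rw [dist_eq_norm, e8, norm_smul, norm_inv, Real.norm_of_nonneg hh0.le, inv_mul_lt_iff₀ hh0]
  nlinarith

/-- **Generation theorem** for maximal quasi-dissipative operators in a Hilbert space. -/
theorem QuasiDissipative.exists_semigroup [CompleteSpace X] (hω : 0 ≤ ω)
    (hA : QuasiDissipative A ω)
    (hr : ∀ c, ω < c → ∀ z : X, ∃ x y, (x, y) ∈ A.graph ∧ c • x - y = z) :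
    ∃ S : C0Semigroup X, S.IsGeneratedBy A ∧ ∀ t, ‖S.op t‖ ≤ Real.exp (2 * ω * t) := by
  -- the parameters exceed `2 ω`, the growth of the semigroups, and tend to infinity
  set c : ℕ → ℝ := fun n => 2 * ω + 1 + n with hc
  have hcω : ∀ n, ω < c n := fun n => by
    have : (0 : ℝ) ≤ n := n.cast_nonneg
    simp only [hc]
    linarith
  have hc2 : ∀ n, 2 * ω ≤ c n := fun n => by
    have : (0 : ℝ) ≤ n := n.cast_nonneg
    simp only [hc]
    linarith
  have hc0 : ∀ n, 0 < c n := fun n => hω.trans_lt (hcω n)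
  have hcT : Tendsto c atTop atTop :=
    tendsto_atTop_add_const_left _ _ tendsto_natCast_atTop_atTop
  choose R hR1 hR2 hR3 using fun n => hA.exists_resolvent (hcω n) (hr (c n) (hcω n))
  have hR : ∀ m n, Commute (R m) (R n) := by
    -- the resolvent identity `(c m - c n) R m R n = R n - R m`
    intro m n
    have key : ∀ m n z, (c m - c n) • R m (R n z) = R n z - R m z := by
      intro m n z
      have h := hR3 m _ _ (hR2 n z)
      have e : c m • R n z - (c n • R n z - z) = (c m - c n) • R n z + z := by module
      rw [e, map_add, map_smul] at h
      rw [eq_sub_iff_add_eq, h]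
    rcases eq_or_ne m n with rfl | hmn
    · exact Commute.refl _
    have hne : c m - c n ≠ 0 := by
      simpa [hc, sub_eq_zero] using hmn
    ext z
    have h1 := key m n z
    have h2 := key n m z
    have h3 : (c m - c n) • (R m (R n z) - R n (R m z)) = 0 := by
      rw [smul_sub, h1]
      rw [← neg_sub (c m), neg_smul] at h2
      rw [sub_eq_add_neg, h2]
      abel
    exact sub_eq_zero.1 ((smul_eq_zero.1 h3).resolve_left hne)
  set B : ℕ → X →L[ℝ] X := fun n => c n ^ 2 • R n - c n • (1 : X →L[ℝ] X) with hB
  have hBB : ∀ m n, Commute (B m) (B n) := fun m n =>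
    ((((hR m n).smul_left _).smul_right _).sub_right ((Commute.one_right _).smul_right _)).sub_left
      ((Commute.one_left _).smul_left _)
  have hdense : Dense (A.domain : Set X) := hA.dense_domain (hcω 0) (hr _ (hcω 0))
  have hexp : ∀ n, ∀ t : ℝ, 0 ≤ t → ‖NormedSpace.exp (t • B n)‖ ≤ Real.exp (2 * ω * t) :=
    fun n t ht => norm_exp_yosida_le hω (hc0 n) (hc2 n) (hR1 n) ht
  -- the operators `c R` converge strongly to the identity
  have hid : ∀ z, Tendsto (fun n => c n • R n z) atTop (𝓝 z) := by
    have hdom : ∀ x y, (x, y) ∈ A.graph → Tendsto (fun n => c n • R n x) atTop (𝓝 x) := by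
      intro x y hxy
      have h1 : ∀ n, c n • R n x = x + R n y := fun n => by
        have h := hR3 n x y hxy
        rw [map_sub, map_smul, sub_eq_iff_eq_add] at h
        exact h
      simp only [h1]
      have h2 : Tendsto (fun n => R n y) atTop (𝓝 0) := by
        refine squeeze_zero_norm (fun n => (R n).le_of_opNorm_le (hR1 n) y) ?_
        have h3 := tendsto_inv_atTop_zero.comp (tendsto_atTop_add_const_right _ (-ω) hcT)
        simpa [Function.comp_def, sub_eq_add_neg] using h3.mul_const ‖y‖
      simpa using h2.const_add x
    intro z
    rw [Metric.tendsto_atTop]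
    intro ε hε
    obtain ⟨x, hx, hxz⟩ := hdense.exists_dist_lt z (ε := ε / 6) (by positivity)
    obtain ⟨N, hN⟩ := Metric.tendsto_atTop.1 (hdom x _ (A.mem_graph ⟨x, hx⟩)) (ε / 2)
      (by positivity)
    refine ⟨N, fun n hn => ?_⟩
    have h1 := hN n hn
    have h2 : ‖c n • R n (z - x)‖ ≤ 2 * ‖z - x‖ := by
      rw [norm_smul, Real.norm_of_nonneg (hc0 n).le]
      refine (mul_le_mul_of_nonneg_left ((R n).le_of_opNorm_le (hR1 n) _) (hc0 n).le).trans ?_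
      rw [← mul_assoc]
      refine mul_le_mul_of_nonneg_right ?_ (norm_nonneg _)
      rw [← div_eq_mul_inv, div_le_iff₀ (sub_pos.2 (hcω n))]
      linarith [hc2 n]
    rw [dist_eq_norm] at h1 hxz ⊢
    have h3 : c n • R n z - z = c n • R n (z - x) + (c n • R n x - x) - (z - x) := by
      rw [map_sub, smul_sub]
      abel
    rw [h3]
    refine (norm_sub_le _ _).trans_lt ?_
    linarith [norm_add_le (c n • R n (z - x)) (c n • R n x - x)]
  have hBlim : ∀ x y, (x, y) ∈ A.graph → Tendsto (fun n => B n x) atTop (𝓝 y) := by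
    intro x y hxy
    refine (hid y).congr fun n => ?_
    have h := hR3 n x y hxy
    rw [map_sub, map_smul, sub_eq_iff_eq_add, ← sub_eq_iff_eq_add'] at h
    change c n • R n y = c n ^ 2 • R n x - c n • x
    rw [← h]
    module
  have hdC : Dense {x : X | CauchySeq fun n => B n x} := hdense.mono fun x hx =>
    (hBlim x _ (A.mem_graph ⟨x, hx⟩)).cauchySeq
  obtain ⟨S, hS1, hS2⟩ := exists_semigroup_limit hBB (by positivity : 0 ≤ 2 * ω) hexp hdC
  refine ⟨S, ?_, hS1⟩
  have hfwd : ∀ x y, (x, y) ∈ A.graph →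
      Tendsto (fun h : ℝ≥0 => (h : ℝ)⁻¹ • (S.op h x - x)) (𝓝[>] 0) (𝓝 y) :=
    fun x y hxy => tendsto_slope_of_exp_limit (by positivity) hexp hS2 (hBlim x y hxy)
  intro x y
  refine ⟨hfwd x y, fun hxy => ?_⟩
  -- maximality: `c x - y = c x' - y'` for some `(x', y')` in the graph, and `x' = x` because
  -- `S` grows slower than `exp (c t)`
  obtain ⟨x', y', hx', e⟩ := hr (2 * ω + 1) (by linarith) ((2 * ω + 1) • x - y)
  have hz : y - y' = (2 * ω + 1) • (x - x') := by
    rw [smul_sub, ← sub_eq_zero]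
    rw [← sub_eq_zero] at e
    rw [← e]
    abel
  have h1 := (hxy.sub (hfwd x' y' hx')).inner (𝕜 := ℝ) (tendsto_const_nhds (x := x - x'))
  have h2 : Tendsto (fun h : ℝ≥0 => (h : ℝ)⁻¹ * (Real.exp (2 * ω * h) - 1) * ‖x - x'‖ ^ 2)
      (𝓝[>] 0) (𝓝 (2 * ω * ‖x - x'‖ ^ 2)) := by
    have h3 : HasDerivAt (fun h : ℝ => Real.exp (2 * ω * h)) (2 * ω) 0 := by
      simpa using ((hasDerivAt_id (0 : ℝ)).const_mul (2 * ω)).exp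
    have h4 := h3.tendsto_slope_zero
    simp only [zero_add, mul_zero, Real.exp_zero, smul_eq_mul] at h4
    have h5 : Tendsto (fun h : ℝ≥0 => (h : ℝ)) (𝓝[>] 0) (𝓝[≠] 0) := by
      refine tendsto_nhdsWithin_iff.2 ⟨?_, ?_⟩
      · exact (NNReal.continuous_coe.tendsto 0).mono_left nhdsWithin_le_nhds
      · filter_upwards [self_mem_nhdsWithin] with h hh
        exact (NNReal.coe_pos.2 hh).ne'
    exact (h4.comp h5).mul_const _
  have h3 := le_of_tendsto_of_tendsto h1 h2 (by
    filter_upwards [self_mem_nhdsWithin] with h hh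
    have hh0 : (0 : ℝ) < h := NNReal.coe_pos.2 hh
    rw [← smul_sub, real_inner_smul_left, mul_assoc]
    refine mul_le_mul_of_nonneg_left ?_ (inv_nonneg.2 hh0.le)
    have e1 : S.op h x - x - (S.op h x' - x') = S.op h (x - x') - (x - x') := by
      rw [map_sub]
      abel
    rw [e1, inner_sub_left, real_inner_self_eq_norm_sq]
    have e2 : inner ℝ (S.op h (x - x')) (x - x') ≤ Real.exp (2 * ω * h) * ‖x - x'‖ * ‖x - x'‖ :=
      (real_inner_le_norm _ _).trans (mul_le_mul_of_nonneg_right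
        ((S.op h).le_of_opNorm_le (hS1 h) _) (norm_nonneg _))
    nlinarith)
  rw [hz, real_inner_smul_left, real_inner_self_eq_norm_sq] at h3
  have h4 : ‖x - x'‖ ^ 2 = 0 := by nlinarith [sq_nonneg ‖x - x'‖]
  have h5 : x - x' = 0 := by simpa using h4
  rw [h5, smul_zero] at hz
  rwa [sub_eq_zero.1 h5, sub_eq_zero.1 hz]

end HilleYosida

/-! ### The Duhamel formula with a bounded time-dependent perturbation -/

section Duhamel

variable {Y : Type*} [NormedAddCommGroup Y] [NormedSpace ℝ Y]

namespace C0Semigroup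

/-- A semigroup with a locally bounded norm is jointly continuous in time and space. -/
theorem continuous_uncurry (U : C0Semigroup Y) {β : ℝ} (hU : ∀ t, ‖U.op t‖ ≤ Real.exp (β * t)) :
    Continuous fun z : ℝ≥0 × Y => U.op z.1 z.2 := by
  rw [continuous_iff_continuousAt]
  rintro ⟨t₀, y₀⟩
  have h1 : Tendsto (fun z : ℝ≥0 × Y => Real.exp (β * z.1) * ‖z.2 - y₀‖ +
      ‖U.op z.1 y₀ - U.op t₀ y₀‖) (𝓝 (t₀, y₀)) (𝓝 0) := by
    have hc : Continuous fun z : ℝ≥0 × Y => Real.exp (β * z.1) * ‖z.2 - y₀‖ +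
        ‖U.op z.1 y₀ - U.op t₀ y₀‖ := by
      have := (U.continuous_orbit y₀).comp (continuous_fst (X := ℝ≥0) (Y := Y))
      simp only [Function.comp_def] at this
      fun_prop
    simpa using hc.tendsto (t₀, y₀)
  rw [ContinuousAt, tendsto_iff_norm_sub_tendsto_zero]
  refine squeeze_zero (fun _ => norm_nonneg _) (fun z => ?_) h1
  have e : U.op z.1 z.2 - U.op t₀ y₀ = U.op z.1 (z.2 - y₀) + (U.op z.1 y₀ - U.op t₀ y₀) := by
    rw [map_sub]
    abel
  rw [e]
  exact (norm_add_le _ _).trans (add_le_add_left ((U.op z.1).le_of_opNorm_le (hU _) _) _)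

/-- The rescaled semigroup `e^{-κ t} U(t)`. -/
def rescale (U : C0Semigroup Y) (κ : ℝ) : C0Semigroup Y where
  op t := Real.exp (-κ * t) • U.op t
  op_zero := by simp [U.op_zero]
  op_add s t := by
    ext y
    simp [U.op_add, mul_add, Real.exp_add, mul_smul, smul_comm (Real.exp (-(κ * t)))]
  continuous_orbit y := by
    have := U.continuous_orbit y
    simp only [FunLike.coe_smul, Pi.smul_apply]
    fun_prop

theorem norm_rescale_le (U : C0Semigroup Y) {β : ℝ} (hU : ∀ t, ‖U.op t‖ ≤ Real.exp (β * t))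
    (κ : ℝ) (t : ℝ≥0) : ‖(U.rescale κ).op t‖ ≤ Real.exp ((β - κ) * t) := by
  change ‖Real.exp (-κ * t) • U.op t‖ ≤ _
  rw [norm_smul, Real.norm_of_nonneg (Real.exp_pos _).le, sub_eq_add_neg, add_comm, add_mul,
    Real.exp_add]
  exact mul_le_mul_of_nonneg_left (hU t) (Real.exp_pos _).le

end C0Semigroup

variable {U : C0Semigroup Y} {T : ℝ} {β : ℝ}

/-- Truncation of the time `t - s` at `0` makes the integrand defined, and measurable, for all
`s`. -/
theorem aestronglyMeasurable_conv (hU : ∀ t, ‖U.op t‖ ≤ Real.exp (β * t)) {g : ℝ → Y}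
    {ν : Measure ℝ} (hg : AEStronglyMeasurable g ν) (t : ℝ) :
    AEStronglyMeasurable (fun s => U.op (t - s).toNNReal (g s)) ν :=
  (U.continuous_uncurry hU).comp_aestronglyMeasurable
    ((by fun_prop : Continuous fun s : ℝ => (t - s).toNNReal).aestronglyMeasurable.prodMk hg)

theorem norm_conv_le (hU : ∀ t, ‖U.op t‖ ≤ Real.exp (β * t)) (hβ : 0 ≤ β) {s t : ℝ}
    (hs : 0 ≤ s) (ht : t ∈ Icc 0 T) (y : Y) :
    ‖U.op (t - s).toNNReal y‖ ≤ Real.exp (β * T) * ‖y‖ := by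
  refine (U.op _).le_of_opNorm_le ((hU _).trans (Real.exp_le_exp.2 ?_)) y
  refine mul_le_mul_of_nonneg_left ?_ hβ
  rw [Real.coe_toNNReal']
  exact max_le (by linarith [ht.2]) (ht.1.trans ht.2)

theorem integrableOn_conv (hU : ∀ t, ‖U.op t‖ ≤ Real.exp (β * t)) (hβ : 0 ≤ β) {g : ℝ → Y}
    (hg : IntegrableOn g (Ioo 0 T)) {t : ℝ} (ht : t ∈ Icc 0 T) :
    IntegrableOn (fun s => U.op (t - s).toNNReal (g s)) (Ioo 0 T) := by
  refine (hg.norm.const_mul (Real.exp (β * T))).mono' (aestronglyMeasurable_conv hU hg.1 t) ?_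
  filter_upwards [ae_restrict_mem measurableSet_Ioo] with s hs
  exact norm_conv_le hU hβ hs.1.le ht _

theorem intervalIntegrable_of_Ioo {Y : Type*} [NormedAddCommGroup Y] {g : ℝ → Y}
    (hg : IntegrableOn g (Ioo 0 T)) {t : ℝ} (ht : t ∈ Icc 0 T) : IntervalIntegrable g volume 0 t := by
  rw [intervalIntegrable_iff_integrableOn_Ioo_of_le ht.1]
  exact hg.mono_set (Ioo_subset_Ioo_right ht.2)

/-- The convolution `∫₀ᵗ U(t-s) g(s) ds` is continuous in `t`. -/
theorem continuous_conv (hU : ∀ t, ‖U.op t‖ ≤ Real.exp (β * t)) (hβ : 0 ≤ β)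
    {g : ℝ → Y} (hg : IntegrableOn g (Ioo 0 T)) :
    Continuous fun t : Icc 0 T => ∫ s in (0 : ℝ)..t, U.op ((t : ℝ) - s).toNNReal (g s) := by
  -- over the fixed interval the integrand is continuous in `t` except at `t = s`
  have e : ∀ t : Icc 0 T, ∫ s in (0 : ℝ)..t, U.op ((t : ℝ) - s).toNNReal (g s) =
      ∫ s in Ioo 0 T, (Iio (t : ℝ)).indicator (fun s => U.op ((t : ℝ) - s).toNNReal (g s)) s := by
    intro t
    rw [intervalIntegral.integral_of_le t.2.1, integral_Ioc_eq_integral_Ioo,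
      setIntegral_indicator measurableSet_Iio]
    congr 2
    ext s
    simp only [mem_Ioo, mem_inter_iff, mem_Iio]
    exact ⟨fun h => ⟨⟨h.1, h.2.trans_le t.2.2⟩, h.2⟩, fun h => ⟨h.1.1, h.2⟩⟩
  simp only [e]
  rw [continuous_iff_continuousAt]
  intro t₀
  refine continuousAt_of_dominated (bound := fun s => Real.exp (β * T) * ‖g s‖) ?_ ?_
    (hg.norm.const_mul _) ?_
  · exact Eventually.of_forall fun t =>
      (aestronglyMeasurable_conv hU hg.1 t).indicator measurableSet_Iio
  · refine Eventually.of_forall fun t => ?_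
    filter_upwards [ae_restrict_mem measurableSet_Ioo] with s hs
    exact (norm_indicator_le_norm_self _ _).trans (norm_conv_le hU hβ hs.1.le t.2 _)
  · have hne : ∀ᵐ s ∂(volume.restrict (Ioo 0 T)), s ≠ (t₀ : ℝ) :=
      ae_restrict_of_ae (by simp [ae_iff])
    filter_upwards [hne] with s hs
    rcases hs.lt_or_gt with h | h
    · have hc : Continuous fun t : Icc 0 T => U.op ((t : ℝ) - s).toNNReal (g s) :=
        (U.continuous_orbit (g s)).comp (by fun_prop)
      refine hc.continuousAt.congr ?_
      filter_upwards [continuous_subtype_val.continuousAt.eventually (lt_mem_nhds h)] with t ht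
      rw [indicator_of_mem (show s ∈ Iio (t : ℝ) from ht)]
    · refine (continuousAt_const (y := (0 : Y))).congr ?_
      filter_upwards [continuous_subtype_val.continuousAt.eventually (gt_mem_nhds h)] with t ht
      rw [indicator_of_notMem (show s ∉ Iio (t : ℝ) from not_lt.2 (le_of_lt ht))]

/-- The Duhamel formula for `W' = (generator of U) W + p(t) B W + F(t)`, `W(0) = W₀`. -/
def IsMildSolution (U : C0Semigroup Y) (hT : 0 < T) (B : Y →L[ℝ] Y) (p : ℝ → ℝ) (F : ℝ → Y)
    (W₀ : Y) (W : C(Icc 0 T, Y)) : Prop :=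
  ∀ t : Icc 0 T, W t = U.op (t : ℝ).toNNReal W₀ +
    ∫ s in (0 : ℝ)..t, U.op ((t : ℝ) - s).toNNReal (p s • B (W (projIcc 0 T hT.le s)) + F s)

theorem integrableOn_smul_comp (hT : 0 < T) (B : Y →L[ℝ] Y) {p : ℝ → ℝ}
    (hp : IntegrableOn p (Ioo 0 T)) (W : C(Icc 0 T, Y)) :
    IntegrableOn (fun s => p s • B (W (projIcc 0 T hT.le s))) (Ioo 0 T) := by
  have hc : Continuous fun s => B (W (projIcc 0 T hT.le s)) :=
    B.continuous.comp (W.continuous.comp continuous_projIcc)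
  refine (hp.norm.const_mul (‖B‖ * ‖W‖)).mono' (hp.1.smul hc.aestronglyMeasurable) ?_
  refine Eventually.of_forall fun s => ?_
  rw [norm_smul, mul_comm]
  exact mul_le_mul_of_nonneg_right
    (B.le_opNorm_of_le (W.norm_coe_le_norm _)) (norm_nonneg _)

/-- Multiplication of a continuous path by `e^{κ t}`. -/
def expMul (κ : ℝ) (W : C(Icc 0 T, Y)) : C(Icc 0 T, Y) :=
  ⟨fun t => Real.exp (κ * t) • W t, by fun_prop⟩

theorem expMul_expMul (κ : ℝ) (W : C(Icc 0 T, Y)) : expMul (-κ) (expMul κ W) = W := by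
  ext t
  simp [expMul, smul_smul, ← Real.exp_add]

theorem expMul_expMul' (κ : ℝ) (W : C(Icc 0 T, Y)) : expMul κ (expMul (-κ) W) = W := by
  ext t
  simp [expMul, smul_smul, ← Real.exp_add]

theorem norm_expMul_le {κ : ℝ} (hκ : 0 ≤ κ) (W : C(Icc 0 T, Y)) :
    ‖expMul κ W‖ ≤ Real.exp (κ * T) * ‖W‖ := by
  rw [ContinuousMap.norm_le _ (by positivity)]
  intro t
  change ‖Real.exp (κ * t) • W t‖ ≤ _
  rw [norm_smul, Real.norm_of_nonneg (Real.exp_pos _).le]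
  gcongr
  exacts [t.2.2, W.norm_coe_le_norm t]

/-- If `W` is a mild solution then `e^{-κ t} W(t)` is one for the semigroup `e^{-κ t} U(t)` and the
forcing `e^{-κ t} F(t)`. -/
theorem IsMildSolution.expMul_neg {hT : 0 < T} {B : Y →L[ℝ] Y} {p : ℝ → ℝ} {F : ℝ → Y}
    {W₀ : Y} {W : C(Icc 0 T, Y)} (h : IsMildSolution U hT B p F W₀ W) (κ : ℝ) :
    IsMildSolution (U.rescale κ) hT B p (fun s => Real.exp (-κ * s) • F s) W₀ (expMul (-κ) W) := by
  intro t
  change Real.exp (-κ * t) • W t = Real.exp (-κ * (t : ℝ).toNNReal) • U.op (t : ℝ).toNNReal W₀ + _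
  rw [h t, smul_add, Real.coe_toNNReal _ t.2.1, ← intervalIntegral.integral_smul]
  congr 1
  refine intervalIntegral.integral_congr fun s hs => ?_
  rw [uIcc_of_le t.2.1] at hs
  have hs' : ((projIcc 0 T hT.le s : Icc 0 T) : ℝ) = s := by
    rw [projIcc_of_mem hT.le ⟨hs.1, hs.2.trans t.2.2⟩]
  change _ = Real.exp (-κ * ((t : ℝ) - s).toNNReal) • U.op ((t : ℝ) - s).toNNReal
    (p s • B (Real.exp (-κ * (projIcc 0 T hT.le s : Icc 0 T)) • W (projIcc 0 T hT.le s)) + _)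
  rw [hs', Real.coe_toNNReal _ (sub_nonneg.2 hs.2), map_smul B, smul_comm (p s), ← smul_add,
    map_smul, smul_smul, ← Real.exp_add]
  congr 2
  ring

theorem rescale_rescale (U : C0Semigroup Y) (κ : ℝ) : (U.rescale κ).rescale (-κ) = U := by
  have : ((U.rescale κ).rescale (-κ)).op = U.op := by
    funext t
    change Real.exp (-(-κ) * t) • Real.exp (-κ * t) • U.op t = U.op t
    rw [smul_smul, ← Real.exp_add]
    simp
  cases U
  simpa [C0Semigroup.rescale] using this

theorem isMildSolution_expMul_iff {hT : 0 < T} {B : Y →L[ℝ] Y} {p : ℝ → ℝ} {F : ℝ → Y}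
    {W₀ : Y} {W : C(Icc 0 T, Y)} (κ : ℝ) :
    IsMildSolution (U.rescale κ) hT B p (fun s => Real.exp (-κ * s) • F s) W₀ (expMul (-κ) W) ↔
      IsMildSolution U hT B p F W₀ W := by
  refine ⟨fun h => ?_, fun h => h.expMul_neg κ⟩
  have h1 := h.expMul_neg (-κ)
  rw [rescale_rescale, neg_neg, expMul_expMul'] at h1
  convert h1 using 2 with s
  rw [smul_smul, ← Real.exp_add]
  simp

theorem integral_exp_decay_le {γ : ℝ} (hγ : 0 < γ) (t : ℝ) :
    ∫ s in (0 : ℝ)..t, Real.exp (-γ * (t - s)) ≤ 1 / γ := by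
  have hd : ∀ s ∈ uIcc 0 t, HasDerivAt (fun s => Real.exp (-γ * (t - s)) / γ)
      (Real.exp (-γ * (t - s))) s := by
    intro s _
    have h := ((((hasDerivAt_id s).const_sub t).const_mul (-γ)).exp).div_const γ
    refine h.congr_deriv ?_
    simp only [id]
    field_simp
  rw [intervalIntegral.integral_eq_sub_of_hasDerivAt hd
    (by apply Continuous.intervalIntegrable; fun_prop)]
  have := Real.exp_pos (-γ * (t - 0))
  simp only [sub_self, mul_zero, Real.exp_zero]
  have h2 : 0 ≤ Real.exp (-γ * (t - 0)) / γ := by positivity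
  linarith

/-- If the semigroup decays fast enough, relative to `p` and `B`, the Volterra operator
`V ↦ ∫₀ᵗ U(t-s) p(s) B V(s) ds` is a contraction with constant `1/2`. -/
theorem norm_volterra_le {γ : ℝ} (hT : 0 < T)
    (B : Y →L[ℝ] Y) {p : ℝ → ℝ} (hp : MemLp p 2 (volume.restrict (Ioo 0 T)))
    (hγ : 2 * ‖B‖ ^ 2 * ((∫ s in Ioo 0 T, p s ^ 2) + 1) + 1 ≤ γ)
    (hU : ∀ t, ‖U.op t‖ ≤ Real.exp (-γ * t)) (V : C(Icc 0 T, Y)) {t : ℝ} (ht : t ∈ Icc 0 T) :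
    ‖∫ s in (0 : ℝ)..t, U.op (t - s).toNNReal (p s • B (V (projIcc 0 T hT.le s)))‖ ≤
      1 / 2 * ‖V‖ := by
  set P := ∫ s in Ioo 0 T, p s ^ 2 with hP
  have hP0 : 0 ≤ P := integral_nonneg fun _ => sq_nonneg _
  have hγ0 : 0 < γ := by
    have : 0 ≤ 2 * ‖B‖ ^ 2 * (P + 1) := by positivity
    linarith
  -- Young's inequality `|p| b e ≤ δ p² + b² e² / (4 δ)`, where `δ` makes the integral of the first
  -- term at most `1/4`, and `γ` is large enough for the same to hold of the second
  set δ := 1 / (4 * (P + 1)) with hδ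
  have hδ0 : 0 < δ := by positivity
  have hp2 : IntegrableOn (fun s => p s ^ 2) (Ioo 0 T) := hp.integrable_sq
  have hi1 : IntervalIntegrable (fun s => δ * p s ^ 2) volume 0 t :=
    (intervalIntegrable_of_Ioo hp2 ht).const_mul δ
  have hi2 : IntervalIntegrable
      (fun s => ‖B‖ ^ 2 / (4 * δ) * Real.exp (-(2 * γ) * (t - s))) volume 0 t := by
    apply Continuous.intervalIntegrable
    fun_prop
  have hpt : ∀ s ∈ Ioc 0 t, ‖U.op (t - s).toNNReal (p s • B (V (projIcc 0 T hT.le s)))‖ ≤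
      (δ * p s ^ 2 + ‖B‖ ^ 2 / (4 * δ) * Real.exp (-(2 * γ) * (t - s))) * ‖V‖ := by
    intro s hs
    have h1 := (U.op (t - s).toNNReal).le_of_opNorm_le (hU _) (p s • B (V (projIcc 0 T hT.le s)))
    rw [Real.coe_toNNReal _ (sub_nonneg.2 hs.2), norm_smul, Real.norm_eq_abs] at h1
    set e := Real.exp (-γ * (t - s)) with he
    have e2 : Real.exp (-(2 * γ) * (t - s)) = e ^ 2 := by
      rw [he, ← Real.exp_nat_mul]
      congr 1
      push_cast
      ring
    have h2 : ‖B (V (projIcc 0 T hT.le s))‖ ≤ ‖B‖ * ‖V‖ :=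
      B.le_opNorm_of_le (V.norm_coe_le_norm _)
    have h3 : e * (|p s| * ‖B (V (projIcc 0 T hT.le s))‖) ≤ (|p s| * (‖B‖ * e)) * ‖V‖ := by
      have : 0 ≤ e * |p s| := mul_nonneg (Real.exp_pos _).le (abs_nonneg _)
      nlinarith
    have h4 : |p s| * (‖B‖ * e) ≤ δ * p s ^ 2 + ‖B‖ ^ 2 / (4 * δ) * e ^ 2 := by
      have h5 : 0 ≤ (2 * δ * |p s| - ‖B‖ * e) ^ 2 / (4 * δ) := by positivity
      have h6 : (2 * δ * |p s| - ‖B‖ * e) ^ 2 / (4 * δ) =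
          δ * |p s| ^ 2 + ‖B‖ ^ 2 / (4 * δ) * e ^ 2 - |p s| * (‖B‖ * e) := by
        field_simp
        ring
      rw [h6, sq_abs] at h5
      linarith
    rw [e2]
    exact h1.trans (h3.trans (mul_le_mul_of_nonneg_right h4 (norm_nonneg _)))
  refine (intervalIntegral.norm_integral_le_of_norm_le ht.1
    (ae_of_all _ hpt) ((hi1.add hi2).mul_const _)).trans ?_
  rw [intervalIntegral.integral_mul_const, intervalIntegral.integral_add hi1 hi2,
    intervalIntegral.integral_const_mul, intervalIntegral.integral_const_mul]
  refine mul_le_mul_of_nonneg_right ?_ (norm_nonneg _)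
  have h1 : ∫ s in (0 : ℝ)..t, p s ^ 2 ≤ P := by
    rw [intervalIntegral.integral_of_le ht.1, integral_Ioc_eq_integral_Ioo]
    exact setIntegral_mono_set hp2 (ae_of_all _ fun _ => sq_nonneg _)
      (ae_of_all _ (Ioo_subset_Ioo_right ht.2))
  have h2 := integral_exp_decay_le (mul_pos two_pos hγ0) t
  have h3 : δ * ∫ s in (0 : ℝ)..t, p s ^ 2 ≤ 1 / 4 := by
    refine (mul_le_mul_of_nonneg_left h1 hδ0.le).trans ?_
    rw [hδ, div_mul_eq_mul_div, one_mul, div_le_div_iff₀ (by positivity) (by positivity)]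
    linarith
  have h4 : ‖B‖ ^ 2 / (4 * δ) * ∫ s in (0 : ℝ)..t, Real.exp (-(2 * γ) * (t - s)) ≤ 1 / 4 := by
    refine (mul_le_mul_of_nonneg_left h2 (by positivity)).trans ?_
    have : ‖B‖ ^ 2 / (4 * δ) = ‖B‖ ^ 2 * (P + 1) := by
      rw [hδ]
      field_simp
    rw [this, mul_one_div, div_le_div_iff₀ (by positivity) (by positivity)]
    linarith
  linarith

/-- Well-posedness of the Duhamel formula for a rapidly decaying semigroup. -/
theorem wellPosed_of_decay [CompleteSpace Y] {γ : ℝ} (hT : 0 < T)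
    (B : Y →L[ℝ] Y) {p : ℝ → ℝ} (hp : MemLp p 2 (volume.restrict (Ioo 0 T)))
    (hγ : 2 * ‖B‖ ^ 2 * ((∫ s in Ioo 0 T, p s ^ 2) + 1) + 1 ≤ γ)
    (hU : ∀ t, ‖U.op t‖ ≤ Real.exp (-γ * t)) {F : ℝ → Y} (hF : IntegrableOn F (Ioo 0 T)) (W₀ : Y) :
    ∃ W : C(Icc 0 T, Y), IsMildSolution U hT B p F W₀ W ∧
      (∀ W', IsMildSolution U hT B p F W₀ W' → W' = W) ∧
      ‖W‖ ≤ 2 * (‖W₀‖ + ∫ s in Ioo 0 T, ‖F s‖) := by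
  have hγ0 : 0 < γ := by
    have : 0 ≤ ∫ s in Ioo 0 T, p s ^ 2 := integral_nonneg fun _ => sq_nonneg _
    have : 0 ≤ 2 * ‖B‖ ^ 2 * ((∫ s in Ioo 0 T, p s ^ 2) + 1) := by positivity
    linarith
  have hU1 : ∀ t, ‖U.op t‖ ≤ 1 := fun t => (hU t).trans (Real.exp_le_one_iff.2 (by
    have : (0 : ℝ) ≤ t := t.2
    nlinarith))
  have hU0 : ∀ t, ‖U.op t‖ ≤ Real.exp (0 * t) := by simpa using hU1
  have hp1 : IntegrableOn p (Ioo 0 T) := hp.integrable one_le_two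
  have hint := fun W : C(Icc 0 T, Y) => integrableOn_smul_comp hT B hp1 W
  let K : C(Icc 0 T, Y) → C(Icc 0 T, Y) := fun W =>
    ⟨fun t => ∫ s in (0 : ℝ)..t, U.op ((t : ℝ) - s).toNNReal (p s • B (W (projIcc 0 T hT.le s))),
      continuous_conv hU0 le_rfl (hint W)⟩
  let d : C(Icc 0 T, Y) :=
    ⟨fun t => U.op (t : ℝ).toNNReal W₀ + ∫ s in (0 : ℝ)..t, U.op ((t : ℝ) - s).toNNReal (F s),
      ((U.continuous_orbit W₀).comp (by fun_prop)).add (continuous_conv hU0 le_rfl hF)⟩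
  have hK : ∀ V, ‖K V‖ ≤ 1 / 2 * ‖V‖ := fun V => (ContinuousMap.norm_le _ (by positivity)).2
    fun t => norm_volterra_le hT B hp hγ hU V t.2
  have hKsub : ∀ V V', K V - K V' = K (V - V') := by
    intro V V'
    ext t
    rw [ContinuousMap.sub_apply]
    simp only [K, ContinuousMap.coe_mk]
    rw [← intervalIntegral.integral_sub
      (intervalIntegrable_of_Ioo (integrableOn_conv hU0 le_rfl (hint V) t.2) t.2)
      (intervalIntegrable_of_Ioo (integrableOn_conv hU0 le_rfl (hint V') t.2) t.2)]
    congr 1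
    funext s
    rw [← map_sub, ← smul_sub, ← map_sub]
    rfl
  have hiff : ∀ W, IsMildSolution U hT B p F W₀ W ↔ d + K W = W := by
    intro W
    rw [DFunLike.ext_iff]
    refine forall_congr' fun t => ?_
    rw [eq_comm]
    change _ ↔ U.op (t : ℝ).toNNReal W₀ + (∫ s in (0 : ℝ)..t, U.op ((t : ℝ) - s).toNNReal (F s)) +
      (∫ s in (0 : ℝ)..t, U.op ((t : ℝ) - s).toNNReal (p s • B (W (projIcc 0 T hT.le s)))) = W t
    rw [add_assoc, add_comm (∫ s in (0 : ℝ)..t, U.op ((t : ℝ) - s).toNNReal (F s)),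
      ← intervalIntegral.integral_add
        (intervalIntegrable_of_Ioo (integrableOn_conv hU0 le_rfl (hint W) t.2) t.2)
        (intervalIntegrable_of_Ioo (integrableOn_conv hU0 le_rfl hF t.2) t.2)]
    simp only [map_add]
  have hcontr : ContractingWith (1 / 2 : ℝ≥0) fun W => d + K W := by
    refine ⟨by rw [← NNReal.coe_lt_coe]; norm_num, LipschitzWith.of_dist_le_mul fun V V' => ?_⟩
    rw [dist_add_left, dist_eq_norm, dist_eq_norm, hKsub]
    simpa using hK (V - V')
  have hd : ‖d‖ ≤ ‖W₀‖ + ∫ s in Ioo 0 T, ‖F s‖ := by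
    have h0 : 0 ≤ ∫ s in Ioo 0 T, ‖F s‖ := integral_nonneg fun _ => norm_nonneg _
    refine (ContinuousMap.norm_le _ (by positivity)).2 fun t => ?_
    refine (norm_add_le _ _).trans (add_le_add ?_ ?_)
    · simpa using (U.op (t : ℝ).toNNReal).le_of_opNorm_le (hU1 _) W₀
    · refine (intervalIntegral.norm_integral_le_of_norm_le t.2.1 (g := fun s => ‖F s‖)
        (ae_of_all _ fun s _ => ?_) (intervalIntegrable_of_Ioo hF t.2).norm).trans ?_
      · simpa using (U.op ((t : ℝ) - s).toNNReal).le_of_opNorm_le (hU1 _) (F s)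
      · rw [intervalIntegral.integral_of_le t.2.1, integral_Ioc_eq_integral_Ioo]
        exact setIntegral_mono_set hF.norm (ae_of_all _ fun _ => norm_nonneg _)
          (ae_of_all _ (Ioo_subset_Ioo_right t.2.2))
  refine ⟨ContractingWith.fixedPoint _ hcontr, (hiff _).2 hcontr.fixedPoint_isFixedPt,
    fun W' h => hcontr.fixedPoint_unique ((hiff W').1 h), ?_⟩
  have h1 : d + K (ContractingWith.fixedPoint _ hcontr) = ContractingWith.fixedPoint _ hcontr :=
    hcontr.fixedPoint_isFixedPt
  have h2 := hK (ContractingWith.fixedPoint _ hcontr)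
  have h3 := norm_add_le d (K (ContractingWith.fixedPoint _ hcontr))
  rw [h1] at h3
  linarith

/-- Well-posedness of `W' = (generator of U) W + p(t) B W + F(t)` in the mild sense, with a bound
uniform in the data; rescaling in time reduces this to a rapidly decaying semigroup. -/
theorem wellPosed [CompleteSpace Y] (hβ : 0 ≤ β) (hU : ∀ t, ‖U.op t‖ ≤ Real.exp (β * t))
    (hT : 0 < T) (B : Y →L[ℝ] Y) {p : ℝ → ℝ} (hp : MemLp p 2 (volume.restrict (Ioo 0 T))) :
    ∃ C : ℝ, 0 < C ∧ ∀ F : ℝ → Y, IntegrableOn F (Ioo 0 T) → ∀ W₀ : Y,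
      ∃ W : C(Icc 0 T, Y), IsMildSolution U hT B p F W₀ W ∧
        (∀ W', IsMildSolution U hT B p F W₀ W' → W' = W) ∧
        ‖W‖ ≤ C * (‖W₀‖ + ∫ s in Ioo 0 T, ‖F s‖) := by
  set γ := 2 * ‖B‖ ^ 2 * ((∫ s in Ioo 0 T, p s ^ 2) + 1) + 1 with hγ
  have hγ0 : 0 < γ := by
    have : 0 ≤ ∫ s in Ioo 0 T, p s ^ 2 := integral_nonneg fun _ => sq_nonneg _
    positivity
  set κ := β + γ with hκ
  have hκ0 : 0 ≤ κ := by positivity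
  have hdecay : ∀ t, ‖(U.rescale κ).op t‖ ≤ Real.exp (-γ * t) := fun t => by
    have h := U.norm_rescale_le hU κ t
    rwa [hκ, sub_add_cancel_left] at h
  refine ⟨Real.exp (κ * T) * 2, by positivity, fun F hF W₀ => ?_⟩
  have hle : ∀ s ∈ Ioo 0 T, ‖Real.exp (-κ * s) • F s‖ ≤ ‖F s‖ := fun s hs => by
    rw [norm_smul, Real.norm_of_nonneg (Real.exp_pos _).le]
    refine mul_le_of_le_one_left (norm_nonneg _) (Real.exp_le_one_iff.2 ?_)
    nlinarith [hs.1]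
  have hF' : IntegrableOn (fun s => Real.exp (-κ * s) • F s) (Ioo 0 T) := by
    refine hF.norm.mono' (AEStronglyMeasurable.smul (by fun_prop) hF.1) ?_
    filter_upwards [ae_restrict_mem measurableSet_Ioo] with s hs using hle s hs
  obtain ⟨V, hV, huniq, hb⟩ := wellPosed_of_decay hT B hp hγ.symm.le hdecay hF' W₀
  refine ⟨expMul κ V, ?_, fun W' h => ?_, ?_⟩
  · rw [← isMildSolution_expMul_iff κ, expMul_expMul]
    exact hV
  · rw [← huniq _ (h.expMul_neg κ), expMul_expMul']
  · refine (norm_expMul_le hκ0 V).trans ?_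
    rw [mul_assoc]
    refine mul_le_mul_of_nonneg_left (hb.trans ?_) (Real.exp_pos _).le
    have := setIntegral_mono_on hF'.norm hF.norm measurableSet_Ioo hle
    linarith

end Duhamel

/-! ### Primitives with respect to the degenerate weight, and completeness of `H¹_α` -/

section Weighted

variable {α : ℝ}

/-- Properties that hold almost everywhere on each `[ε, 1]` hold almost everywhere on `(0, 1)`. -/
theorem ae_Ioo_of_ae_uIcc {P : ℝ → Prop}
    (h : ∀ ε ∈ Ioo (0 : ℝ) 1, ∀ᵐ x : ℝ, x ∈ uIcc ε 1 → P x) :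
    ∀ᵐ x ∂(volume.restrict (Ioo (0 : ℝ) 1)), P x := by
  have key : ∀ n : ℕ, ∀ᵐ x : ℝ, x ∈ uIcc (1 / ((n : ℝ) + 2)) 1 → P x := by
    intro n
    refine h _ ⟨by positivity, ?_⟩
    rw [div_lt_one (by positivity)]
    linarith [n.cast_nonneg (α := ℝ)]
  rw [ae_restrict_iff' measurableSet_Ioo]
  filter_upwards [ae_all_iff.2 key] with x hx hx01
  obtain ⟨n, hn⟩ := exists_nat_one_div_lt hx01.1
  refine hx n ?_
  have hle : 1 / ((n : ℝ) + 2) ≤ x := by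
    refine le_trans ?_ hn.le
    apply one_div_le_one_div_of_le <;> [positivity; linarith]
  rw [uIcc_of_le (hle.trans hx01.2.le)]
  exact ⟨hle, hx01.2.le⟩

theorem absolutelyContinuousOnInterval_const (c a b : ℝ) :
    AbsolutelyContinuousOnInterval (fun _ : ℝ => c) a b := by
  simpa [AbsolutelyContinuousOnInterval] using tendsto_const_nhds

theorem IsAC.of_absolutelyContinuousOnInterval {φ : ℝ → ℝ}
    (h : AbsolutelyContinuousOnInterval φ 0 1) : IsAC α φ := by
  unfold IsAC
  split_ifs
  · exact h
  · intro ε hε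
    refine h.mono ?_
    rw [uIcc_of_le hε.2.le, uIcc_of_le zero_le_one]
    exact Icc_subset_Icc_left hε.1.le

/-- The function `φ` vanishing at `1` with `x^{α/2} φ' = g`. The base point is `1` because
`s^{-α/2} g(s)` need not be integrable at `0` when `1 ≤ α`. -/
def primitive (α : ℝ) (g : ℝ → ℝ) (x : ℝ) : ℝ := ∫ s in (1 : ℝ)..x, s ^ (-(α / 2)) * g s

theorem rpow_neg_mul_rpow {x : ℝ} (hx : 0 < x) (a y : ℝ) : x ^ (-a) * (x ^ a * y) = y := by
  rw [← mul_assoc, ← Real.rpow_add hx, neg_add_cancel, Real.rpow_zero, one_mul]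

theorem rpow_mul_rpow_neg {x : ℝ} (hx : 0 < x) (a y : ℝ) : x ^ a * (x ^ (-a) * y) = y := by
  rw [← mul_assoc, ← Real.rpow_add hx, add_neg_cancel, Real.rpow_zero, one_mul]

theorem memLp_indicator_rpow (hα : 0 ≤ α) {ε : ℝ} (hε : 0 < ε) :
    MemLp ((Ioo ε 1).indicator fun s : ℝ => s ^ (-(α / 2))) ∞
      (volume.restrict (Ioo (0 : ℝ) 1)) := by
  refine memLp_top_of_bound (Measurable.aestronglyMeasurable
    (Measurable.indicator (by fun_prop) measurableSet_Ioo)) (ε ^ (-(α / 2))) (ae_of_all _ fun s => ?_)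
  by_cases hs : s ∈ Ioo ε 1
  · rw [indicator_of_mem hs, Real.norm_of_nonneg (Real.rpow_nonneg (hε.trans hs.1).le _)]
    exact Real.rpow_le_rpow_of_nonpos hε hs.1.le (by linarith)
  · rw [indicator_of_notMem hs, norm_zero]
    exact Real.rpow_nonneg hε.le _

theorem intervalIntegrable_rpow_mul (hα : 0 ≤ α) {g : ℝ → ℝ}
    (hg : MemLp g 2 (volume.restrict (Ioo (0 : ℝ) 1))) {ε : ℝ} (hε : ε ∈ Ioo (0 : ℝ) 1) :
    IntervalIntegrable (fun s => s ^ (-(α / 2)) * g s) volume ε 1 := by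
  rw [intervalIntegrable_iff_integrableOn_Ioo_of_le hε.2.le]
  have h1 : MemLp (fun s => (Ioo ε 1).indicator (fun s : ℝ => s ^ (-(α / 2))) s * g s) 2
      (volume.restrict (Ioo (0 : ℝ) 1)) := hg.mul (memLp_indicator_rpow hα hε.1)
  have h2 := IntegrableOn.mono_set (h1.integrable one_le_two)
    (Ioo_subset_Ioo_left (b := 1) hε.1.le)
  refine h2.congr_fun (fun s hs => ?_) measurableSet_Ioo
  simp only [indicator_of_mem hs]

theorem intervalIntegrable_rpow_mul_of_lt (h1 : α < 1) {g : ℝ → ℝ}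
    (hg : MemLp g 2 (volume.restrict (Ioo (0 : ℝ) 1))) :
    IntervalIntegrable (fun s => s ^ (-(α / 2)) * g s) volume 0 1 := by
  rw [intervalIntegrable_iff_integrableOn_Ioo_of_le zero_le_one]
  have h2 : MemLp (fun s : ℝ => s ^ (-(α / 2))) 2 (volume.restrict (Ioo (0 : ℝ) 1)) := by
    rw [memLp_two_iff_integrable_sq (by fun_prop : Measurable _).aestronglyMeasurable]
    refine IntegrableOn.congr_fun (f := fun s : ℝ => s ^ (-α))
      ((intervalIntegral.integrableOn_Ioo_rpow_iff one_pos).2 (by linarith)) (fun s hs => ?_)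
      measurableSet_Ioo
    change s ^ (-α) = (s ^ (-(α / 2))) ^ 2
    rw [← Real.rpow_natCast, ← Real.rpow_mul hs.1.le]
    congr 1
    push_cast
    ring
  exact h2.integrable_mul hg

theorem isAC_primitive (hα : 0 ≤ α) {g : ℝ → ℝ}
    (hg : MemLp g 2 (volume.restrict (Ioo (0 : ℝ) 1))) : IsAC α (primitive α g) := by
  unfold IsAC
  split_ifs with h1
  · exact (intervalIntegrable_rpow_mul_of_lt h1 hg).absolutelyContinuousOnInterval_intervalIntegral
      right_mem_uIcc
  · exact fun ε hε => (intervalIntegrable_rpow_mul hα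
      hg hε).absolutelyContinuousOnInterval_intervalIntegral right_mem_uIcc

theorem deriv_primitive (hα : 0 ≤ α) {g : ℝ → ℝ}
    (hg : MemLp g 2 (volume.restrict (Ioo (0 : ℝ) 1))) :
    ∀ᵐ x ∂(volume.restrict (Ioo (0 : ℝ) 1)), deriv (primitive α g) x = x ^ (-(α / 2)) * g x := by
  refine ae_Ioo_of_ae_uIcc fun ε hε => ?_
  filter_upwards [(intervalIntegrable_rpow_mul hα hg hε).ae_hasDerivAt_integral] with x hx hxε
  exact (hx hxε 1 right_mem_uIcc).deriv

theorem eq_add_primitive {φ g : ℝ → ℝ} (hφ : IsAC α φ)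
    (h : g =ᵐ[volume.restrict (Ioo (0 : ℝ) 1)] fun x => x ^ (α / 2) * deriv φ x) {x : ℝ}
    (hx : x ∈ Ioo (0 : ℝ) 1) : φ x = φ 1 + primitive α g x := by
  have h1 := (hφ.local hx).integral_deriv_eq_sub
  have h2 : ∫ s in x..1, deriv φ s = ∫ s in x..1, s ^ (-(α / 2)) * g s := by
    rw [intervalIntegral.integral_of_le hx.2.le, intervalIntegral.integral_of_le hx.2.le,
      integral_Ioc_eq_integral_Ioo, integral_Ioc_eq_integral_Ioo]
    refine integral_congr_ae ?_
    have hsub : Ioo x 1 ⊆ Ioo 0 1 := Ioo_subset_Ioo_left hx.1.le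
    filter_upwards [ae_restrict_of_ae_restrict_of_subset hsub h,
      ae_restrict_mem measurableSet_Ioo] with s hs hsm
    rw [hs, rpow_neg_mul_rpow (hx.1.trans hsm.1)]
  rw [primitive, intervalIntegral.integral_symm, ← h2, h1]
  ring

theorem mem_gradGraph_of_ae (hα : 0 ≤ α) {u g : L2I} {c : ℝ}
    (h : u =ᵐ[volume.restrict (Ioo (0 : ℝ) 1)] fun x => c + primitive α g x) :
    (u, g) ∈ gradGraph α := by
  refine ⟨fun x => c + primitive α g x, (IsAC.of_absolutelyContinuousOnInterval
    (absolutelyContinuousOnInterval_const c 0 1)).add (isAC_primitive hα (Lp.memLp g)), h, ?_⟩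
  filter_upwards [deriv_primitive hα (Lp.memLp g), ae_mem] with x hx hx1
  rw [deriv_const_add, hx, rpow_mul_rpow_neg hx1.1]

theorem exists_ae_eq_of_mem_gradGraph {u g : L2I} (h : (u, g) ∈ gradGraph α) :
    ∃ c : ℝ, u =ᵐ[volume.restrict (Ioo (0 : ℝ) 1)] fun x => c + primitive α g x := by
  obtain ⟨φ, hφ, e1, e2⟩ := h
  refine ⟨φ 1, ?_⟩
  filter_upwards [e1, ae_mem] with x hx hx1
  exact hx.trans (eq_add_primitive hφ e2 hx1)

/-- Evaluation of the primitive at an interior point is a bounded functional on `L²(0,1)`. -/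
theorem exists_primitive_eq_inner (hα : 0 ≤ α) {x : ℝ} (hx : x ∈ Ioo (0 : ℝ) 1) :
    ∃ k : L2I, ∀ g : L2I, primitive α g x = inner ℝ k g := by
  have hk : MemLp ((Ioo x 1).indicator fun s : ℝ => -s ^ (-(α / 2))) 2
      (volume.restrict (Ioo (0 : ℝ) 1)) := by
    have := ((memLp_indicator_rpow hα hx.1).mono_exponent (p := 2) le_top).neg
    refine (memLp_congr_ae (ae_of_all _ fun s => ?_)).1 this
    by_cases hs : s ∈ Ioo x 1 <;> simp [hs]
  refine ⟨hk.toLp _, fun g => ?_⟩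
  rw [L2.inner_def, primitive, intervalIntegral.integral_symm,
    intervalIntegral.integral_of_le hx.2.le, integral_Ioc_eq_integral_Ioo, ← integral_neg]
  have e : ∫ s in Ioo x 1, -(s ^ (-(α / 2)) * g s) =
      ∫ s in Ioo 0 1, (Ioo x 1).indicator (fun s => -(s ^ (-(α / 2)) * g s)) s := by
    rw [setIntegral_indicator measurableSet_Ioo,
      inter_eq_right.2 (Ioo_subset_Ioo_left hx.1.le)]
  rw [e]
  refine integral_congr_ae ?_
  filter_upwards [hk.coeFn_toLp] with s hs
  rw [hs]
  by_cases hs : s ∈ Ioo x 1 <;> simp [hs, mul_comm]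

theorem exists_ae_tendsto_subseq {u : ℕ → L2I} {v : L2I} (h : Tendsto u atTop (𝓝 v)) :
    ∃ ns : ℕ → ℕ, StrictMono ns ∧ ∀ᵐ x ∂(volume.restrict (Ioo (0 : ℝ) 1)),
      Tendsto (fun n => u (ns n) x) atTop (𝓝 (v x)) :=
  (tendstoInMeasure_of_tendsto_Lp h).exists_seq_tendsto_ae

instance : NeBot (ae (volume.restrict (Ioo (0 : ℝ) 1))) := by
  rw [ae_neBot, Ne, Measure.restrict_eq_zero]
  simp

/-- The operator `u ↦ x^{α/2} u_x` is closed: in `u n = c n + primitive α (g n)` the primitives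
converge pointwise, hence so do the constants, along a subsequence. -/
theorem isClosed_gradGraph (hα : 0 ≤ α) : IsClosed (gradGraph α : Set (L2I × L2I)) := by
  refine IsSeqClosed.isClosed fun z w hz hzw => ?_
  choose c hc using fun n => exists_ae_eq_of_mem_gradGraph (hz n)
  obtain ⟨ns, hns, hae⟩ := exists_ae_tendsto_subseq ((continuous_fst.tendsto w).comp hzw)
  have hprim : ∀ x ∈ Ioo (0 : ℝ) 1, Tendsto (fun n => primitive α (z (ns n)).2 x) atTop
      (𝓝 (primitive α w.2 x)) := by
    intro x hx
    obtain ⟨k, hk⟩ := exists_primitive_eq_inner hα hx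
    simp only [hk]
    exact tendsto_const_nhds.inner
      (((continuous_snd.tendsto w).comp hzw).comp hns.tendsto_atTop)
  have hlim : ∀ᵐ x ∂(volume.restrict (Ioo (0 : ℝ) 1)),
      Tendsto (fun n => c (ns n)) atTop (𝓝 (w.1 x - primitive α w.2 x)) := by
    filter_upwards [hae, ae_mem, ae_all_iff.2 hc] with x h1 hx h2
    refine (h1.sub (hprim x hx)).congr fun n => ?_
    change (z (ns n)).1 x - _ = _
    rw [h2 (ns n)]
    ring
  obtain ⟨x₀, hx₀⟩ := hlim.exists
  refine mem_gradGraph_of_ae (c := w.1 x₀ - primitive α w.2 x₀) hα ?_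
  filter_upwards [hlim] with x hx
  rw [tendsto_nhds_unique hx₀ hx]
  ring

end Weighted

/-! ### Weak form of the degenerate elliptic operator -/

section Weak

variable {α : ℝ}

/-- A function with square integrable derivative that vanishes at `0` is `O(√x)`. -/
theorem sq_le_mul_norm_sq {q : ℝ → ℝ} {h : L2I} (hq : AbsolutelyContinuousOnInterval q 0 1)
    (hq' : h =ᵐ[volume.restrict (Ioo (0 : ℝ) 1)] deriv q) (hq0 : q 0 = 0) {x : ℝ}
    (hx : x ∈ Ioo (0 : ℝ) 1) : q x ^ 2 ≤ x * ‖h‖ ^ 2 := by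
  have hm : (volume.restrict (Ioo (0 : ℝ) 1)) (Ioo 0 x) ≠ ∞ := measure_ne_top _ _
  have h1 : inner ℝ (indicatorConstLp 2 measurableSet_Ioo hm (1 : ℝ)) h = q x := by
    rw [L2.inner_indicatorConstLp_one, Measure.restrict_restrict measurableSet_Ioo,
      inter_eq_left.2 (Ioo_subset_Ioo_right hx.2.le),
      integral_congr_ae (ae_restrict_of_ae_restrict_of_subset (Ioo_subset_Ioo_right hx.2.le) hq'),
      ← integral_Ioc_eq_integral_Ioo, ← intervalIntegral.integral_of_le hx.1.le,
      (hq.mono (by rw [uIcc_of_le hx.1.le, uIcc_of_le zero_le_one]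
                   exact Icc_subset_Icc_right hx.2.le)).integral_deriv_eq_sub, hq0, sub_zero]
  have h2 : ‖indicatorConstLp 2 measurableSet_Ioo hm (1 : ℝ)‖ ^ 2 = x := by
    rw [norm_indicatorConstLp (by norm_num) (by norm_num), norm_one, one_mul, measureReal_def,
      Measure.restrict_apply measurableSet_Ioo, inter_eq_left.2 (Ioo_subset_Ioo_right hx.2.le),
      Real.volume_Ioo, sub_zero, ENNReal.toReal_ofReal hx.1.le, ← Real.rpow_natCast,
      ← Real.rpow_mul hx.1.le]
    norm_num
  have h3 := abs_real_inner_le_norm (indicatorConstLp 2 measurableSet_Ioo hm (1 : ℝ)) h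
  rw [h1] at h3
  calc q x ^ 2 = |q x| ^ 2 := (sq_abs _).symm
    _ ≤ (‖indicatorConstLp 2 measurableSet_Ioo hm (1 : ℝ)‖ * ‖h‖) ^ 2 := by gcongr
    _ = x * ‖h‖ ^ 2 := by rw [mul_pow, h2]

/-- If `q = O(√x)` and `ψ` is square integrable then `q ψ` has no nonzero limit at `0`: otherwise
`1 / x = O(ψ²)` would be integrable near `0`. -/
theorem eq_zero_of_tendsto_mul {q ψ : ℝ → ℝ} {C l : ℝ}
    (hq : ∀ x ∈ Ioo (0 : ℝ) 1, q x ^ 2 ≤ x * C)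
    (hψ : MemLp ψ 2 (volume.restrict (Ioo (0 : ℝ) 1)))
    (hl : Tendsto (fun x => q x * ψ x) (𝓝[>] 0) (𝓝 l)) : l = 0 := by
  by_contra hne
  have hl2 : 0 < l ^ 2 := by positivity
  have h1 : ∀ᶠ x in 𝓝[>] (0 : ℝ), l ^ 2 / 2 < (q x * ψ x) ^ 2 :=
    (hl.pow 2).eventually (lt_mem_nhds (by linarith))
  obtain ⟨δ, hδ, hsub⟩ := mem_nhdsGT_iff_exists_Ioo_subset.1
    (inter_mem h1 (Ioo_mem_nhdsGT (zero_lt_one' ℝ)))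
  have hδ1 : Ioo 0 δ ⊆ Ioo (0 : ℝ) 1 := fun x hx => (hsub hx).2
  have h2 : IntegrableOn (fun x => 2 * C / l ^ 2 * ψ x ^ 2) (Ioo 0 δ) :=
    IntegrableOn.mono_set (hψ.integrable_sq.const_mul _) hδ1
  have h3 : IntegrableOn (fun x : ℝ => x ^ (-1 : ℝ)) (Ioo 0 δ) := by
    refine h2.mono' (by fun_prop : Measurable _).aestronglyMeasurable ?_
    filter_upwards [ae_restrict_mem measurableSet_Ioo] with x hx
    have hx0 : 0 < x := hx.1
    have h4 : l ^ 2 / 2 < (q x * ψ x) ^ 2 := (hsub hx).1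
    have h5 := mul_le_mul_of_nonneg_right (hq x (hδ1 hx)) (sq_nonneg (ψ x))
    rw [Real.rpow_neg_one, norm_inv, Real.norm_of_nonneg hx0.le, inv_le_iff_one_le_mul₀ hx0,
      div_mul_eq_mul_div, div_mul_eq_mul_div, le_div_iff₀ hl2]
    nlinarith
  have h6 := (intervalIntegral.integrableOn_Ioo_rpow_iff hδ).1 h3
  exact lt_irrefl _ h6

theorem inner_eq_intervalIntegral (u v : L2I) : inner ℝ u v = ∫ x in (0 : ℝ)..1, u x * v x := by
  rw [L2.inner_def, intervalIntegral.integral_of_le zero_le_one, integral_Ioc_eq_integral_Ioo]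
  refine integral_congr_ae (ae_of_all _ fun x => ?_)
  simp [mul_comm]

theorem intervalIntegrable_mul (u v : L2I) :
    IntervalIntegrable (fun x => u x * v x) volume 0 1 := by
  rw [intervalIntegrable_iff_integrableOn_Ioo_of_le zero_le_one]
  exact (Lp.memLp u).integrable_mul (Lp.memLp v)

theorem intervalIntegral_congr_ae_Ioo {f g : ℝ → ℝ} {a : ℝ} (ha : a ∈ Ico (0 : ℝ) 1)
    (h : f =ᵐ[volume.restrict (Ioo (0 : ℝ) 1)] g) : ∫ x in a..1, f x = ∫ x in a..1, g x := by
  rw [intervalIntegral.integral_of_le ha.2.le, intervalIntegral.integral_of_le ha.2.le,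
    integral_Ioc_eq_integral_Ioo, integral_Ioc_eq_integral_Ioo]
  exact integral_congr_ae (ae_restrict_of_ae_restrict_of_subset (Ioo_subset_Ioo_left ha.1) h)

/-- Integration by parts: the boundary term at `0` vanishes because it has a limit, while
`(x^α u_x)(x) = O(√x)` and `v ∈ L²(0,1)`. -/
theorem inner_ell_eq {u h : L2I} (huh : (u, h) ∈ ellGraph α) :
    ∃ g, (u, g) ∈ gradGraph α ∧ ∀ v k, (v, k) ∈ gradGraph α → inner ℝ h v = -inner ℝ g k := by
  obtain ⟨φ, q, hφ, e1, hm, hq, eq, e2, hq0, hq1⟩ := huh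
  refine ⟨hm.toLp _, ⟨φ, hφ, e1, hm.coeFn_toLp⟩, ?_⟩
  rintro v k ⟨ψ, hψ, e3, e4⟩
  have hw : (fun x => h x * v x + hm.toLp _ x * k x) =ᵐ[volume.restrict (Ioo (0 : ℝ) 1)]
      fun x => deriv q x * ψ x + q x * deriv ψ x := by
    filter_upwards [e2, e3, e4, eq, hm.coeFn_toLp, ae_mem] with x h1 h2 h3 h4 h5 hx
    have h6 : x ^ (α / 2) * x ^ (α / 2) = x ^ α := by
      rw [← Real.rpow_add hx.1, add_halves]
    change h x = _ at h1
    change v x = _ at h2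
    change k x = _ at h3
    rw [h1, h2, h3, h4, h5, ← h6]
    ring
  set w : ℝ → ℝ := fun x => h x * v x + hm.toLp _ x * k x with hw_def
  have hwi : IntervalIntegrable w volume 0 1 :=
    (intervalIntegrable_mul h v).add (intervalIntegrable_mul _ k)
  have key : ∀ x ∈ Ioo (0 : ℝ) 1, q x * ψ x = -∫ s in x..1, w s := by
    intro x hx
    rw [intervalIntegral_congr_ae_Ioo ⟨hx.1.le, hx.2⟩ hw,
      (AbsolutelyContinuousOnInterval.integral_deriv_mul_eq_sub (hq.mono (by
        rw [uIcc_of_le hx.2.le, uIcc_of_le zero_le_one]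
        exact Icc_subset_Icc_left hx.1.le)) (hψ.local hx)), hq1]
    ring
  have hlim : Tendsto (fun x => q x * ψ x) (𝓝[>] 0) (𝓝 (-∫ s in (0 : ℝ)..1, w s)) := by
    have hc : ContinuousOn (fun x => ∫ s in (1 : ℝ)..x, w s) (uIcc 0 1) :=
      intervalIntegral.continuousOn_primitive_interval' hwi right_mem_uIcc
    rw [uIcc_of_le zero_le_one] at hc
    have h1 := (hc 0 ⟨le_rfl, zero_le_one⟩).tendsto.mono_left
      (nhdsWithin_le_of_mem (Icc_mem_nhdsGT (zero_lt_one' ℝ)))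
    rw [intervalIntegral.integral_symm] at h1
    refine h1.congr' ?_
    filter_upwards [Ioo_mem_nhdsGT (zero_lt_one' ℝ)] with x hx
    rw [key x hx, intervalIntegral.integral_symm]
  have hzero := eq_zero_of_tendsto_mul (fun x hx => sq_le_mul_norm_sq hq e2 hq0 hx)
    ((memLp_congr_ae e3).1 (Lp.memLp v)) hlim
  rw [neg_eq_zero, intervalIntegral.integral_add (intervalIntegrable_mul h v)
    (intervalIntegrable_mul _ k)] at hzero
  rw [inner_eq_intervalIntegral, inner_eq_intervalIntegral]
  linarith

theorem exists_one_mem_gradGraph : ∃ e : L2I, (e, (0 : L2I)) ∈ gradGraph α ∧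
    e =ᵐ[volume.restrict (Ioo (0 : ℝ) 1)] fun _ => 1 := by
  have h1 : MemLp (fun _ : ℝ => (1 : ℝ)) 2 (volume.restrict (Ioo (0 : ℝ) 1)) := memLp_const 1
  refine ⟨h1.toLp _, ⟨fun _ => 1, IsAC.of_absolutelyContinuousOnInterval
    (absolutelyContinuousOnInterval_const 1 0 1), h1.coeFn_toLp, ?_⟩, h1.coeFn_toLp⟩
  filter_upwards [Lp.coeFn_zero ℝ 2 (volume.restrict (Ioo (0 : ℝ) 1))] with x hx
  simpa using hx

/-- A weak solution of `(x^α u_x)_x = h` with natural boundary conditions is a strong one: the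
primitive `q` of `h` satisfies `x^{-α/2} q = x^{α/2} u_x`, as is seen by testing with functions
that are constant near `0`. -/
theorem mem_ellGraph_of_weak (hα : 0 ≤ α) {u g h : L2I} (hug : (u, g) ∈ gradGraph α)
    (hw : ∀ v k, (v, k) ∈ gradGraph α → inner ℝ h v = -inner ℝ g k) : (u, h) ∈ ellGraph α := by
  obtain ⟨φ, hφ, e1, e2⟩ := id hug
  have hhi : IntervalIntegrable h volume 0 1 := by
    rw [intervalIntegrable_iff_integrableOn_Ioo_of_le zero_le_one]
    exact (Lp.memLp h).integrable one_le_two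
  set q : ℝ → ℝ := fun x => ∫ s in (0 : ℝ)..x, h s with hq_def
  have hq : AbsolutelyContinuousOnInterval q 0 1 :=
    hhi.absolutelyContinuousOnInterval_intervalIntegral left_mem_uIcc
  have hq' : h =ᵐ[volume.restrict (Ioo (0 : ℝ) 1)] deriv q := by
    have h1 := hhi.ae_hasDerivAt_integral
    rw [Filter.EventuallyEq, ae_restrict_iff' measurableSet_Ioo]
    filter_upwards [h1] with x hx hx1
    rw [uIcc_of_le zero_le_one] at hx
    exact (hx (Ioo_subset_Icc_self hx1) 0 ⟨le_rfl, zero_le_one⟩).deriv.symm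
  have hq0 : q 0 = 0 := intervalIntegral.integral_same
  have hq1 : q 1 = 0 := by
    -- test with the constant `1`
    obtain ⟨e, he, he1⟩ := exists_one_mem_gradGraph (α := α)
    have h1 := hw e 0 he
    rw [inner_zero_right, neg_zero, inner_eq_intervalIntegral] at h1
    rw [← h1]
    refine intervalIntegral_congr_ae_Ioo ⟨le_rfl, one_pos⟩ ?_
    filter_upwards [he1] with x hx
    rw [hx, mul_one]
  have hqc : ContinuousOn q (Icc 0 1) := by
    have := hq.continuousOn
    rwa [uIcc_of_le zero_le_one] at this
  have hqtop : MemLp q ∞ (volume.restrict (Ioo (0 : ℝ) 1)) := by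
    obtain ⟨C, hC⟩ := hq.exists_bound
    refine memLp_top_of_bound ((hqc.mono Ioo_subset_Icc_self).aestronglyMeasurable
      measurableSet_Ioo) C ?_
    filter_upwards [ae_mem] with x hx
    refine hC x ?_
    rw [uIcc_of_le zero_le_one]
    exact Ioo_subset_Icc_self hx
  have key : ∀ ε ∈ Ioo (0 : ℝ) 1, ∀ᵐ x ∂(volume.restrict (Ioo (0 : ℝ) 1)), x ∈ Ioo ε 1 →
      x ^ (-(α / 2)) * q x = g x := by
    intro ε hε
    set r : ℝ → ℝ := (Ioo ε 1).indicator fun s : ℝ => s ^ (-(α / 2)) with hr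
    have hrtop : MemLp r ∞ (volume.restrict (Ioo (0 : ℝ) 1)) := memLp_indicator_rpow hα hε.1
    -- testing with the primitive of `ψ`, which is constant near `0`, gives `∫ ψ² = 0`
    set ψ : ℝ → ℝ := (Ioo ε 1).indicator fun s : ℝ => s ^ (-(α / 2)) * q s - g s with hψ_def
    have hψ : MemLp ψ 2 (volume.restrict (Ioo (0 : ℝ) 1)) := by
      have h1 : MemLp (fun s => r s * q s) 2 (volume.restrict (Ioo (0 : ℝ) 1)) :=
        (hqtop.mono_exponent (p := 2) le_top).mul hrtop
      have h2 := h1.sub ((Lp.memLp g).indicator (s := Ioo ε 1) measurableSet_Ioo)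
      refine (memLp_congr_ae (ae_of_all _ fun s => ?_)).1 h2
      by_cases hs : s ∈ Ioo ε 1 <;> simp [hψ_def, hr, hs]
    have hrψ : ∀ s, r s * ψ s = s ^ (-(α / 2)) * ψ s := fun s => by
      by_cases hs : s ∈ Ioo ε 1 <;> simp [hψ_def, hr, hs]
    have hi : IntervalIntegrable (fun s => s ^ (-(α / 2)) * ψ s) volume 0 1 := by
      rw [intervalIntegrable_iff_integrableOn_Ioo_of_le zero_le_one]
      have h1 : MemLp (fun s => r s * ψ s) 2 (volume.restrict (Ioo (0 : ℝ) 1)) := hψ.mul hrtop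
      refine (h1.integrable one_le_two).congr (ae_of_all _ hrψ)
    have hvAC : AbsolutelyContinuousOnInterval (primitive α ψ) 0 1 :=
      hi.absolutelyContinuousOnInterval_intervalIntegral right_mem_uIcc
    have hvc : ContinuousOn (primitive α ψ) (Icc 0 1) := by
      have := hvAC.continuousOn
      rwa [uIcc_of_le zero_le_one] at this
    have hv2 : MemLp (primitive α ψ) 2 (volume.restrict (Ioo (0 : ℝ) 1)) := by
      obtain ⟨C, hC⟩ := hvAC.exists_bound
      refine MemLp.of_bound ((hvc.mono Ioo_subset_Icc_self).aestronglyMeasurable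
        measurableSet_Ioo) C ?_
      filter_upwards [ae_mem] with x hx
      refine hC x ?_
      rw [uIcc_of_le zero_le_one]
      exact Ioo_subset_Icc_self hx
    have hmem : ((hv2.toLp _, hψ.toLp _) : L2I × L2I) ∈ gradGraph α := by
      refine ⟨primitive α ψ, IsAC.of_absolutelyContinuousOnInterval hvAC, hv2.coeFn_toLp, ?_⟩
      filter_upwards [hψ.coeFn_toLp, deriv_primitive hα hψ, ae_mem] with x h1 h2 hx
      rw [h1, h2, rpow_mul_rpow_neg hx.1]
    have hw1 := hw _ _ hmem
    have hparts := hq.integral_deriv_mul_eq_sub hvAC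
    rw [hq0, hq1, zero_mul, zero_mul, sub_zero] at hparts
    have h3 : ∫ x in (0 : ℝ)..1, ψ x * ψ x = 0 := by
      have e5 : (fun x => deriv q x * primitive α ψ x + q x * deriv (primitive α ψ) x)
          =ᵐ[volume.restrict (Ioo (0 : ℝ) 1)] fun x => h x * hv2.toLp _ x +
            (g x * hψ.toLp _ x + hψ.toLp _ x * hψ.toLp _ x) := by
        filter_upwards [hq', hv2.coeFn_toLp, hψ.coeFn_toLp, deriv_primitive hα hψ]
          with x h1 h2 h3 h4
        rw [h1, h2, h3, h4]
        by_cases hs : x ∈ Ioo ε 1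
        · simp only [hψ_def, indicator_of_mem hs]
          ring
        · simp [hψ_def, hs]
      rw [intervalIntegral_congr_ae_Ioo ⟨le_rfl, one_pos⟩ e5,
        intervalIntegral.integral_add (intervalIntegrable_mul _ _)
          ((intervalIntegrable_mul _ _).add (intervalIntegrable_mul _ _)),
        intervalIntegral.integral_add (intervalIntegrable_mul _ _) (intervalIntegrable_mul _ _),
        ← inner_eq_intervalIntegral, ← inner_eq_intervalIntegral, hw1, neg_add_cancel_left]
        at hparts
      refine Eq.trans ?_ hparts
      refine intervalIntegral_congr_ae_Ioo ⟨le_rfl, one_pos⟩ ?_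
      filter_upwards [hψ.coeFn_toLp] with x hx
      rw [hx]
    rw [intervalIntegral.integral_of_le zero_le_one, integral_Ioc_eq_integral_Ioo,
      integral_eq_zero_iff_of_nonneg (fun x => mul_self_nonneg (ψ x)) (hψ.integrable_mul hψ)] at h3
    filter_upwards [h3] with x hx hxε
    have h4 : ψ x = 0 := mul_self_eq_zero.1 hx
    simp only [hψ_def, indicator_of_mem hxε] at h4
    exact sub_eq_zero.1 h4
  have hgq : ∀ᵐ x ∂(volume.restrict (Ioo (0 : ℝ) 1)), x ^ (-(α / 2)) * q x = g x := by
    refine ae_Ioo_of_ae_uIcc fun ε hε => ?_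
    have h1 := key (ε / 2) ⟨by linarith [hε.1], by linarith [hε.1, hε.2]⟩
    rw [ae_restrict_iff' measurableSet_Ioo] at h1
    filter_upwards [h1, (by simp [ae_iff] : ∀ᵐ x : ℝ, x ≠ 1)] with x hx hx1 hxε
    rw [uIcc_of_le hε.2.le] at hxε
    have hlt := lt_of_le_of_ne hxε.2 hx1
    exact hx ⟨hε.1.trans_le hxε.1, hlt⟩ ⟨by linarith [hxε.1, hε.1], hlt⟩
  refine ⟨φ, q, hφ, e1, (memLp_congr_ae e2).1 (Lp.memLp g), hq, ?_, hq', hq0, hq1⟩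
  filter_upwards [hgq, e2, ae_mem] with x h1 h2 hx
  have h3 : x ^ α = x ^ (α / 2) * x ^ (α / 2) := by
    rw [← Real.rpow_add hx.1, add_halves]
  rw [h3, mul_assoc, ← h2, ← h1, rpow_mul_rpow_neg hx.1]

end Weak

/-! ### The energy space and the resolvent of the wave operator -/

section GraphNorm

variable {E F : Type*} [NormedAddCommGroup E] [NormedSpace ℝ E]
  [NormedAddCommGroup F] [NormedSpace ℝ F] {A : E →ₗ.[ℝ] F}

namespace GraphSpace

theorem ext {x y : GraphSpace A} (h : x.val = y.val) : x = y := Subtype.ext h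

theorem mem_graph (x : GraphSpace A) : (x.val, x.image) ∈ A.graph := LinearPMap.mem_graph A x

theorem image_eq {x : GraphSpace A} {y : F} (h : (x.val, y) ∈ A.graph) : x.image = y :=
  LinearPMap.mem_graph_snd_inj A x.mem_graph h rfl

theorem exists_of_mem_graph {x : E} {y : F} (h : (x, y) ∈ A.graph) :
    ∃ u : GraphSpace A, u.val = x ∧ u.image = y :=
  ⟨mk x (LinearPMap.mem_domain_of_mem_graph h), rfl, image_eq h⟩

theorem isometry_toGraph : Isometry (toGraph A) := fun _ _ => rfl

theorem toGraph_eq (x : GraphSpace A) : toGraph A x = WithLp.toLp 2 (x.val, x.image) := rfl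

theorem norm_val_le (x : GraphSpace A) : ‖x.val‖ ≤ ‖x‖ := by
  refine le_of_sq_le_sq ?_ (norm_nonneg _)
  rw [norm_sq x]
  exact le_add_of_nonneg_right (sq_nonneg _)

theorem norm_image_le (x : GraphSpace A) : ‖x.image‖ ≤ ‖x‖ := by
  refine le_of_sq_le_sq ?_ (norm_nonneg _)
  rw [norm_sq x]
  exact le_add_of_nonneg_left (sq_nonneg _)

/-- The inclusion of `D(A)` in `E`. -/
def valL (A : E →ₗ.[ℝ] F) : GraphSpace A →L[ℝ] E :=
  LinearMap.mkContinuous (A.domain.subtype : GraphSpace A →ₗ[ℝ] E) 1 fun x => by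
    rw [one_mul]
    exact norm_val_le x

/-- The operator `A` as a bounded map on its domain. -/
def imageL (A : E →ₗ.[ℝ] F) : GraphSpace A →L[ℝ] F :=
  LinearMap.mkContinuous (A.toFun : GraphSpace A →ₗ[ℝ] F) 1 fun x => by
    rw [one_mul]
    exact norm_image_le x

theorem valL_apply (x : GraphSpace A) : valL A x = x.val := rfl

theorem imageL_apply (x : GraphSpace A) : imageL A x = x.image := rfl

/-- The domain of a closed operator is complete in the graph norm. -/
theorem completeSpace [CompleteSpace E] [CompleteSpace F] (h : IsClosed (A.graph : Set (E × F))) :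
    CompleteSpace (GraphSpace A) := by
  rw [completeSpace_iff_isComplete_range (isometry_toGraph (A := A)).isUniformInducing]
  have e : range (toGraph A) = WithLp.ofLp ⁻¹' (A.graph : Set (E × F)) := by
    ext z
    constructor
    · rintro ⟨x, rfl⟩
      exact x.mem_graph
    · intro hz
      obtain ⟨u, h1, h2⟩ := exists_of_mem_graph (x := z.fst) (y := z.snd) hz
      refine ⟨u, ?_⟩
      rw [toGraph_eq, h1, h2]
      rfl
  rw [e]
  exact (h.preimage (WithLp.prod_continuous_ofLp 2 E F)).isComplete

end GraphSpace

end GraphNorm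

section HilbertSpace

variable {α : ℝ}

/-- The scalar product `∫ (u v + x^α u_x v_x)` of `H¹_α(0,1)`, which induces the graph norm. -/
instance : InnerProductSpace ℝ (H1 α) where
  inner u v := inner ℝ u.val v.val + inner ℝ u.image v.image
  norm_sq_eq_re_inner u := by
    rw [GraphSpace.norm_sq, real_inner_self_eq_norm_sq, real_inner_self_eq_norm_sq]
    rfl
  conj_inner_symm u v := by
    rw [real_inner_comm u.val, real_inner_comm u.image]
    rfl
  add_left u v w := by
    rw [← GraphSpace.valL_apply (u + v), ← GraphSpace.imageL_apply (u + v), map_add, map_add,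
      inner_add_left, inner_add_left]
    exact add_add_add_comm _ _ _ _
  smul_left u v r := by
    rw [← GraphSpace.valL_apply (r • u), ← GraphSpace.imageL_apply (r • u), map_smul, map_smul,
      inner_smul_left, inner_smul_left, ← mul_add]
    rfl

theorem H1.inner_eq (u v : H1 α) :
    inner ℝ u v = inner ℝ u.val v.val + inner ℝ u.image v.image := rfl

theorem H1.completeSpace (hα : 0 ≤ α) : CompleteSpace (H1 α) := by
  refine GraphSpace.completeSpace ?_
  rw [wgrad_graph]
  exact isClosed_gradGraph hα

/-- `A` is the operator associated with the form `-∫ x^α u_x v_x` on `H¹_α(0,1)`. -/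
theorem mem_ell_graph_iff (hα : 0 ≤ α) (u : H1 α) (h : L2I) :
    (u.val, h) ∈ (ell α).graph ↔ ∀ v : H1 α, inner ℝ h v.val = -inner ℝ u.image v.image := by
  rw [ell_graph]
  constructor
  · intro hu v
    obtain ⟨g, hg, hgw⟩ := inner_ell_eq hu
    rw [← wgrad_graph] at hg
    rw [GraphSpace.image_eq hg]
    refine hgw _ _ ?_
    rw [← wgrad_graph]
    exact v.mem_graph
  · intro hu
    refine mem_ellGraph_of_weak hα (g := u.image) ?_ ?_
    · rw [← wgrad_graph]
      exact u.mem_graph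
    · intro v k hvk
      rw [← wgrad_graph] at hvk
      obtain ⟨w, rfl, rfl⟩ := GraphSpace.exists_of_mem_graph hvk
      exact hu w

theorem mem_waveOp_graph_iff (W W' : State α) :
    (W, W') ∈ (waveOp α).graph ↔ (W.fst.val, W'.snd) ∈ (ell α).graph ∧ W'.fst.val = W.snd := by
  constructor
  · intro h
    obtain ⟨x, h1, h2⟩ := (LinearPMap.mem_graph_iff _).1 h
    dsimp only at h1 h2
    subst h1 h2
    exact ⟨LinearPMap.mem_graph (ell α) ⟨_, x.2.1⟩, rfl⟩
  · rintro ⟨h1, h2⟩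
    have hd : W ∈ (waveOp α).domain :=
      ⟨LinearPMap.mem_domain_of_mem_graph h1, h2 ▸ W'.fst.2⟩
    refine (LinearPMap.mem_graph_iff _).2 ⟨⟨W, hd⟩, rfl, ?_⟩
    have e1 : (waveOp α ⟨W, hd⟩).fst = W'.fst := GraphSpace.ext h2.symm
    have e2 : (waveOp α ⟨W, hd⟩).snd = W'.snd :=
      LinearPMap.mem_graph_snd_inj (ell α) (LinearPMap.mem_graph (ell α) ⟨_, hd.1⟩) h1 rfl
    exact (WithLp.ofLp_injective 2) (Prod.ext e1 e2)

/-- The wave operator is skew-adjoint up to the bounded term `∫ u v` in the energy norm. -/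
theorem quasiDissipative_waveOp (hα : 0 ≤ α) : QuasiDissipative (waveOp α) 1 := by
  intro W W' h
  obtain ⟨h1, h2⟩ := (mem_waveOp_graph_iff W W').1 h
  have h3 := (mem_ell_graph_iff hα _ _).1 h1 W'.fst
  have e : inner ℝ W' W = inner ℝ W.snd W.fst.val := by
    rw [WithLp.prod_inner_apply]
    change inner ℝ W'.fst W.fst + inner ℝ W'.snd W.snd = _
    rw [H1.inner_eq, ← h2, h3, real_inner_comm W.fst.image]
    ring
  have h4 := WithLp.prod_norm_sq_eq_of_L2 W
  have h5 := real_inner_le_norm W.snd W.fst.val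
  have h6 := W.fst.norm_val_le
  rw [e]
  have h7 : ‖W.fst.val‖ ^ 2 ≤ ‖W.fst‖ ^ 2 := pow_le_pow_left₀ (norm_nonneg _) h6 2
  nlinarith [sq_nonneg (‖W.snd‖ - ‖W.fst.val‖), sq_nonneg ‖W.snd‖, sq_nonneg ‖W.fst‖]

/-- Lax–Milgram for the form `c² ∫ u v + ∫ x^α u_x v_x` on `H¹_α(0,1)`. -/
theorem exists_weak_solution (hα : 0 ≤ α) {c : ℝ} (hc : 0 < c) (f : L2I) :
    ∃ u : H1 α, ∀ v : H1 α,
      c ^ 2 * inner ℝ u.val v.val + inner ℝ u.image v.image = inner ℝ f v.val := by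
  have := H1.completeSpace hα
  let V := GraphSpace.valL (wgrad α)
  let G := GraphSpace.imageL (wgrad α)
  let b : H1 α →L[ℝ] H1 α →L[ℝ] ℝ :=
    c ^ 2 • (innerSL ℝ).bilinearComp V V + (innerSL ℝ).bilinearComp G G
  have hb : ∀ u v, b u v = c ^ 2 * inner ℝ u.val v.val + inner ℝ u.image v.image :=
    fun _ _ => rfl
  have hco : IsCoercive b := by
    refine ⟨min (c ^ 2) 1, lt_min (by positivity) one_pos, fun u => ?_⟩
    have h1 : min (c ^ 2) 1 ≤ c ^ 2 := min_le_left _ _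
    have h2 : min (c ^ 2) 1 ≤ 1 := min_le_right _ _
    rw [hb, real_inner_self_eq_norm_sq, real_inner_self_eq_norm_sq, mul_assoc, ← sq,
      GraphSpace.norm_sq]
    nlinarith [sq_nonneg ‖u.val‖, sq_nonneg ‖u.image‖]
  refine ⟨hco.continuousLinearEquivOfBilin.symm (V.adjoint f), fun v => ?_⟩
  rw [← hb, ← hco.continuousLinearEquivOfBilin_apply, ContinuousLinearEquiv.apply_symm_apply,
    ContinuousLinearMap.adjoint_inner_left]
  rfl

/-- Eliminating `w₁ = c w₀ - z₀` from `c W - 𝒜 W = Z` leaves `c² w₀ - A w₀ = z₁ + c z₀`. -/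
theorem exists_waveOp_resolvent (hα : 0 ≤ α) {c : ℝ} (hc : 0 < c) (Z : State α) :
    ∃ W W', (W, W') ∈ (waveOp α).graph ∧ c • W - W' = Z := by
  obtain ⟨u, hu⟩ := exists_weak_solution hα hc (Z.snd + c • Z.fst.val)
  let V := GraphSpace.valL (wgrad α)
  refine ⟨WithLp.toLp 2 (u, c • u.val - Z.fst.val),
    WithLp.toLp 2 (c • u - Z.fst, c ^ 2 • u.val - (Z.snd + c • Z.fst.val)),
    (mem_waveOp_graph_iff _ _).2 ⟨(mem_ell_graph_iff hα u _).2 fun v => ?_, ?_⟩, ?_⟩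
  · change inner ℝ (c ^ 2 • u.val - (Z.snd + c • Z.fst.val)) v.val = _
    rw [inner_sub_left, real_inner_smul_left, ← hu v]
    ring
  · change V (c • u - Z.fst) = c • V u - V Z.fst
    rw [map_sub, map_smul]
  · refine (WithLp.ofLp_injective 2) (Prod.ext ?_ ?_)
    · change c • u - (c • u - Z.fst) = Z.fst
      abel
    · change c • (c • u.val - Z.fst.val) - (c ^ 2 • u.val - (Z.snd + c • Z.fst.val)) = Z.snd
      module

end HilbertSpace

/-! ### The semigroup in the domain of its generator, and the potential -/

section Restriction

variable {X : Type*} [NormedAddCommGroup X]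

/-- A maximal quasi-dissipative operator is closed. -/
theorem QuasiDissipative.isClosed_graph [InnerProductSpace ℝ X] {A : X →ₗ.[ℝ] X} {ω c : ℝ}
    (hA : QuasiDissipative A ω) (hc : ω < c)
    (hr : ∀ z : X, ∃ x y, (x, y) ∈ A.graph ∧ c • x - y = z) :
    IsClosed (A.graph : Set (X × X)) := by
  obtain ⟨R, -, hR1, hR2⟩ := hA.exists_resolvent hc hr
  have e : (A.graph : Set (X × X)) = {z | R (c • z.1 - z.2) = z.1} := by
    ext ⟨x, y⟩
    refine ⟨fun h => hR2 x y h, fun h => ?_⟩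
    have h1 := hR1 (c • x - y)
    rw [show R (c • x - y) = x from h, sub_sub_cancel] at h1
    exact h1
  rw [e]
  exact isClosed_eq (by fun_prop) continuous_fst

variable [NormedSpace ℝ X] {A : X →ₗ.[ℝ] X} {S : C0Semigroup X}

namespace C0Semigroup

/-- The semigroup commutes with its generator. -/
theorem onDomain_image (hS : S.IsGeneratedBy A) (t : ℝ≥0) (x : GraphSpace A) :
    (S.onDomain hS t x).image = S.op t x.image :=
  GraphSpace.image_eq (hS.graph_op t x.mem_graph)

theorem norm_onDomain_le (hS : S.IsGeneratedBy A) (t : ℝ≥0) (x : GraphSpace A) :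
    ‖S.onDomain hS t x‖ ≤ ‖S.op t‖ * ‖x‖ := by
  refine le_of_sq_le_sq ?_ (by positivity)
  rw [mul_pow, GraphSpace.norm_sq, GraphSpace.norm_sq, mul_add, ← mul_pow, ← mul_pow,
    onDomain_image]
  exact add_le_add (pow_le_pow_left₀ (norm_nonneg _) ((S.op t).le_opNorm x.val) 2)
    (pow_le_pow_left₀ (norm_nonneg _) ((S.op t).le_opNorm x.image) 2)

/-- The part of a semigroup in the domain of its generator, with the graph norm. -/
def restrict (S : C0Semigroup X) (hS : S.IsGeneratedBy A) : C0Semigroup (GraphSpace A) where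
  op t := LinearMap.mkContinuous
    { toFun := S.onDomain hS t
      map_add' := fun x y => GraphSpace.ext ((S.op t).map_add x.val y.val)
      map_smul' := fun c x => GraphSpace.ext ((S.op t).map_smul c x.val) } ‖S.op t‖
    (norm_onDomain_le hS t)
  op_zero := by
    ext x
    refine GraphSpace.ext ?_
    change S.op 0 x.val = x.val
    rw [S.op_zero]
    rfl
  op_add s t := by
    ext x
    refine GraphSpace.ext ?_
    change S.op (s + t) x.val = S.op s (S.op t x.val)
    rw [S.op_add]
    rfl
  continuous_orbit x := by
    rw [← (GraphSpace.isometry_toGraph (A := A)).comp_continuous_iff]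
    have e : (GraphSpace.toGraph A ∘ fun t => S.onDomain hS t x) =
        fun t => WithLp.toLp 2 (S.op t x.val, S.op t x.image) := by
      funext t
      rw [Function.comp_apply, GraphSpace.toGraph_eq, onDomain_image]
      rfl
    change Continuous (GraphSpace.toGraph A ∘ fun t => S.onDomain hS t x)
    rw [e]
    exact (WithLp.prod_continuous_toLp 2 X X).comp
      ((S.continuous_orbit _).prodMk (S.continuous_orbit _))

theorem norm_restrict_le (hS : S.IsGeneratedBy A) {β : ℝ}
    (h : ∀ t, ‖S.op t‖ ≤ Real.exp (β * t)) (t : ℝ≥0) :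
    ‖(S.restrict hS).op t‖ ≤ Real.exp (β * t) :=
  (LinearMap.mkContinuous_norm_le _ (norm_nonneg _) (norm_onDomain_le hS t)).trans (h t)

end C0Semigroup

end Restriction

section Potential

variable {α : ℝ}

theorem potMul_eq_of_ae (hα : α < 2) (μ : V1 α) (u w : H1 α)
    (h : w.val =ᵐ[volume.restrict (Ioo (0 : ℝ) 1)] fun x => μ.1.val x * u.val x) :
    potMul hα μ u = w :=
  GraphSpace.ext (Lp.ext ((potMul_spec hα μ u).trans h.symm))

/-- Multiplication by an admissible potential as a linear map of `H¹_α(0,1)`. -/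
def potMulLin (hα : α < 2) (μ : V1 α) : H1 α →ₗ[ℝ] H1 α where
  toFun := potMul hα μ
  map_add' u v := by
    refine potMul_eq_of_ae hα μ _ _ ?_
    change ((potMul hα μ u).val + (potMul hα μ v).val : L2I) =ᵐ[_]
      fun x => μ.1.val x * (u.val + v.val : L2I) x
    filter_upwards [potMul_spec hα μ u, potMul_spec hα μ v, Lp.coeFn_add u.val v.val,
      Lp.coeFn_add (potMul hα μ u).val (potMul hα μ v).val] with x h1 h2 h3 h4
    rw [h3, h4, Pi.add_apply, Pi.add_apply, h1, h2, mul_add]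
  map_smul' c u := by
    refine potMul_eq_of_ae hα μ _ _ ?_
    change (c • (potMul hα μ u).val : L2I) =ᵐ[_] fun x => μ.1.val x * (c • u.val : L2I) x
    filter_upwards [potMul_spec hα μ u, Lp.coeFn_smul c u.val,
      Lp.coeFn_smul c (potMul hα μ u).val] with x h1 h2 h3
    rw [h2, h3, Pi.smul_apply, Pi.smul_apply, h1, smul_eq_mul, smul_eq_mul, mul_left_comm]

/-- Boundedness of the multiplication by a potential, from the closed graph theorem. -/
theorem continuous_potMul (hα₀ : 0 ≤ α) (hα : α < 2) (μ : V1 α) :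
    Continuous (potMulLin hα μ) := by
  have := H1.completeSpace hα₀
  refine LinearMap.continuous_of_seq_closed_graph _ fun u v w hu hw => ?_
  have hu' : Tendsto (fun n => (u n).val) atTop (𝓝 v.val) :=
    ((GraphSpace.valL (wgrad α)).continuous.tendsto v).comp hu
  have hw' : Tendsto (fun n => (potMul hα μ (u n)).val) atTop (𝓝 w.val) :=
    ((GraphSpace.valL (wgrad α)).continuous.tendsto w).comp hw
  obtain ⟨ns, hns, h1⟩ := exists_ae_tendsto_subseq hu'
  obtain ⟨ms, hms, h2⟩ := exists_ae_tendsto_subseq (hw'.comp hns.tendsto_atTop)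
  refine (potMul_eq_of_ae hα μ v w ?_).symm
  filter_upwards [h1, h2, ae_all_iff.2 fun n => potMul_spec hα μ (u n)] with x h3 h4 h5
  refine tendsto_nhds_unique h4 (((h3.comp hms.tendsto_atTop).const_mul (μ.1.val x)).congr ?_)
  exact fun n => (h5 _).symm

/-- The map `h ↦ (0, h)` as a bounded operator. -/
def inrL (α : ℝ) : H1 α →L[ℝ] DWave α :=
  LinearMap.mkContinuous
    { toFun := DWave.inr
      map_add' := fun u v => GraphSpace.ext ((WithLp.ofLp_injective 2)
        (Prod.ext (add_zero (0 : H1 α)).symm rfl))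
      map_smul' := fun c u => GraphSpace.ext ((WithLp.ofLp_injective 2)
        (Prod.ext (smul_zero c).symm rfl)) } 2 fun h => by
    refine le_of_sq_le_sq ?_ (by positivity)
    have h1 : (DWave.inr h).image = WithLp.toLp 2 (h, 0) := GraphSpace.image_eq
      ((mem_waveOp_graph_iff _ _).2 ⟨(ell α).graph.zero_mem, rfl⟩)
    have h2 : (DWave.inr h).val = WithLp.toLp 2 (0, h.val) := rfl
    change ‖DWave.inr h‖ ^ 2 ≤ _
    rw [GraphSpace.norm_sq, h1, h2, WithLp.prod_norm_sq_eq_of_L2, WithLp.prod_norm_sq_eq_of_L2]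
    have h3 := pow_le_pow_left₀ (norm_nonneg _) h.norm_val_le 2
    change ‖(0 : H1 α)‖ ^ 2 + ‖h.val‖ ^ 2 + (‖h‖ ^ 2 + ‖(0 : L2I)‖ ^ 2) ≤ _
    rw [norm_zero, norm_zero]
    nlinarith [sq_nonneg ‖h‖]

/-- The projection of `D(𝒜)` to the first component in `H¹_α(0,1)`. -/
def fstL (α : ℝ) : DWave α →L[ℝ] H1 α :=
  (WithLp.fstL 2 ℝ (H1 α) L2I).comp (GraphSpace.valL (waveOp α))

/-- The operator `ℬ` as a bounded operator in `D(𝒜)`. -/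
def potOpL (hα₀ : 0 ≤ α) (hα : α < 2) (μ : V1 α) : DWave α →L[ℝ] DWave α :=
  (inrL α).comp ((⟨potMulLin hα μ, continuous_potMul hα₀ hα μ⟩ : H1 α →L[ℝ] H1 α).comp (fstL α))

end Potential

/-- On a bounded interval the `L¹` norm is controlled by the `L²` norm. -/
theorem integral_norm_le_of_memLp {Y : Type*} [NormedAddCommGroup Y] {T : ℝ} (hT : 0 < T)
    {F : ℝ → Y} (hF : MemLp F 2 (volume.restrict (Ioo 0 T))) :
    ∫ s in Ioo 0 T, ‖F s‖ ≤
      Real.sqrt T * (eLpNorm F 2 (volume.restrict (Ioo 0 T))).toReal := by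
  have h1 := eLpNorm_le_eLpNorm_mul_rpow_measure_univ (p := 1) (q := 2) one_le_two hF.1
  rw [Measure.restrict_apply_univ, Real.volume_Ioo, sub_zero] at h1
  have h0 : ∫ s in Ioo 0 T, ‖F s‖ = (eLpNorm F 1 (volume.restrict (Ioo 0 T))).toReal := by
    rw [eLpNorm_one_eq_lintegral_enorm, integral_norm_eq_lintegral_enorm hF.1]
  have h2 := ENNReal.toReal_mono (ENNReal.mul_ne_top hF.2.ne (by
    refine ENNReal.rpow_ne_top_of_nonneg ?_ ENNReal.ofReal_ne_top
    norm_num)) h1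
  rw [← h0, ENNReal.toReal_mul, ← ENNReal.toReal_rpow,
    ENNReal.toReal_ofReal hT.le] at h2
  rw [Real.sqrt_eq_rpow, mul_comm]
  convert h2 using 3
  norm_num

end DegenerateWave
end

theorem proposition2p3 (α : ℝ) (hα₀ : 0 ≤ α) (hα₂ : α < 2) :
    -- the operator `𝒜` generates a strongly continuous semigroup `S t = e^{t𝒜}`
    ∃ (S : C0Semigroup (State α))
      (hS : S.IsGeneratedBy (waveOp α)),
    ∀ (T : ℝ) (hT : 0 < T) (p : ℝ → ℝ) (_hp : MemLp p 2 (volume.restrict (Ioo 0 T)))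
      (μ : V1 α),
      -- existence and uniqueness
      (∀ f : ℝ → H1 α, MemLp f 2 (volume.restrict (Ioo 0 T)) →
        ∀ W₀ : DWave α,
          ∃! W : C(Icc 0 T, DWave α),
            IsClassicalSolution hα₂ hS hT p μ f W₀ W) ∧
      -- continuous dependence, with a constant independent of `f` and `W₀`
      (∃ C : ℝ, 0 < C ∧
        ∀ f : ℝ → H1 α, MemLp f 2 (volume.restrict (Ioo 0 T)) →
        ∀ (W₀ : DWave α) (W : C(Icc 0 T, DWave α)),
          IsClassicalSolution hα₂ hS hT p μ f W₀ W →
            ‖W‖ ≤ C * (‖W₀‖ + (eLpNorm (fun s => DWave.inr (f s)) 2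
              (volume.restrict (Ioo 0 T))).toReal)) := by
  have := H1.completeSpace hα₀
  have hdis := quasiDissipative_waveOp hα₀
  have hres : ∀ c, (1 : ℝ) < c → ∀ z : State α, ∃ x y, (x, y) ∈ (waveOp α).graph ∧ c • x - y = z :=
    fun c hc z => exists_waveOp_resolvent hα₀ (one_pos.trans hc) z
  obtain ⟨S, hS, hbound⟩ := hdis.exists_semigroup zero_le_one hres
  -- Bochner integrals in the domain are meaningful because it is complete
  have : CompleteSpace (DWave α) :=
    GraphSpace.completeSpace (hdis.isClosed_graph one_lt_two (hres 2 one_lt_two))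
  refine ⟨S, hS, fun T hT p hp μ => ?_⟩
  have hU : ∀ t, ‖(S.restrict hS).op t‖ ≤ Real.exp (2 * 1 * t) :=
    C0Semigroup.norm_restrict_le hS hbound
  have hF : ∀ f : ℝ → H1 α, MemLp f 2 (volume.restrict (Ioo 0 T)) →
      MemLp (fun s => DWave.inr (f s)) 2 (volume.restrict (Ioo 0 T)) :=
    fun f hf => (inrL α).comp_memLp' hf
  obtain ⟨C, hC, hwp⟩ := wellPosed (by norm_num) hU hT (potOpL hα₀ hα₂ μ) hp
  have hiff : ∀ f : ℝ → H1 α, MemLp f 2 (volume.restrict (Ioo 0 T)) → ∀ W₀ W,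
      IsClassicalSolution hα₂ hS hT p μ f W₀ W ↔
        IsMildSolution (S.restrict hS) hT (potOpL hα₀ hα₂ μ) p (fun s => DWave.inr (f s)) W₀ W := by
    intro f hf W₀ W
    refine forall_congr' fun t => and_iff_right ?_
    exact intervalIntegrable_of_Ioo (integrableOn_conv hU (by norm_num)
      ((integrableOn_smul_comp hT (potOpL hα₀ hα₂ μ) (hp.integrable one_le_two) W).add
        ((hF f hf).integrable one_le_two)) t.2) t.2
  constructor
  · intro f hf W₀
    obtain ⟨W, hW, huniq, -⟩ := hwp _ ((hF f hf).integrable one_le_two) W₀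
    exact ⟨W, (hiff f hf W₀ W).2 hW, fun W' h => huniq W' ((hiff f hf W₀ W').1 h)⟩
  · refine ⟨C * (1 + Real.sqrt T), by positivity, fun f hf W₀ W h => ?_⟩
    obtain ⟨W', -, huniq, hb⟩ := hwp _ ((hF f hf).integrable one_le_two) W₀
    rw [← huniq W ((hiff f hf W₀ W).1 h)] at hb
    refine hb.trans ?_
    rw [mul_assoc]
    refine mul_le_mul_of_nonneg_left ?_ hC.le
    have h1 := integral_norm_le_of_memLp hT (hF f hf)
    have h2 := Real.sqrt_nonneg T
    have h3 := norm_nonneg W₀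
    have h4 : 0 ≤ (eLpNorm (fun s => DWave.inr (f s)) 2 (volume.restrict (Ioo 0 T))).toReal :=
      ENNReal.toReal_nonneg
    nlinarith [mul_nonneg h2 h3]
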